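/- Let $S_\infty$ be the group of permutations of $\{1,2,\dots\}$ fixing all but finitely many elements, $S_n\subset S_\infty$ the subgroup fixing every $k>n$, $s_i=(i,i+1)$, and $\mathrm{Des}(w)=\{i : w(i)>w(i+1)\}$. On $\mathbb Z[x_1,x_2,\dots]$ let $$\partial_i f=\frac{f-f(x_1,\dots,x_{i-1},x_{i+1},x_i,x_{i+2},\dots)}{x_i-x_{i+1}},\qquad R_if=f(x_1,\dots,x_{i-1},0,x_i,x_{i+1},\dots).$$ The Schubert polynomials $(\mathfrak S_w)_{w\in S_\infty}$ are the unique family of homogeneous polynomials with $\mathfrak S_{\mathrm{id}}=1$, $\partial_i\mathfrak S_w=\mathfrak S_{ws_i}$ if $i\in\mathrm{Des}(w)$, and $\partial_i\mathfrak S_w=0$ if $i\notin\mathrm{Des}(w)$. For $w\in S_n$, a (reduced) pipe dream for $w$ is a tiling of the staircase $\{(i,j): i,j\ge 1,\ i+j\le n+1\}$ ($i$ the row, counted from the top, $j$ the column, counted from the left) by crosses (joining left to right and bottom to top) and elbows (joining left to top and bottom to right) such that, for each $1\le i\le n$, the pipe entering from the left in row $i$ exits through the top of column $w(i)$, and no two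 pipes cross more than once. Let $\mathrm{PD}(w)$ be the set of these, and $x^D=\prod_{(i,j)\text{ a cross of }D}x_i$. Theorem. The family of Schubert polynomials exists and is unique, and for all $n\ge 0$ and $w\in S_n$: 1. $\mathfrak S_w=\sum_{D\in\mathrm{PD}(w)}x^D$. 2. The polynomials $P_w=\sum_{D\in\mathrm{PD}(w)}x^D$ satisfy $P_w=R_1P_w+\sum_{i\in\mathrm{Des}(w)}x_iR_iP_{ws_i}$. 3. Shifting all crosses one unit diagonally southwest (from $(i,j)$ to $(i+1,j-1)$) is a bijection $\Phi_0$ from the $D\in\mathrm{PD}(w)$ without crosses in column $1$ to the $D\in\mathrm{PD}(w)$ without crosses in row $1$, and $x^D=R_1x^{\Phi_0(D)}$. 4. For $i\in\mathrm{Des}(w)$, turning the last cross in column $1$ into an elbow and then shifting all crosses in rows $i$ and below one unit diagonally southwest is a bijection $\Phi_i$ from the $D\in\mathrm{PD}(w)$ whose last (lowest) cross in column $1$ is in row $i$ to the $D\in\mathrm{PD}(ws_i)$ without crosses in row $i$, and $x^D=x_iR_ix^{\Phi_i(D)}$. -/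

import Mathlib

/-! Conventions. All indices are shifted to start at `0`: the variable `x_{k+1}` is `MvPolynomial.X k`,
row (column) `k + 1` of a staircase is row (column) `k`, the transposition `s_{k+1} = (k+1, k+2)` is
`Schubert.s k`, the operator `R_{k+1}` is `Schubert.R k`, and so on. -/

namespace Schubert

/-- `Pol = ℤ[x₁, x₂, …]`. -/
abbrev Pol : Type := MvPolynomial ℕ ℤ

/-- `S_∞`: permutations of the index set that fix all but finitely many elements. -/
def SInf : Subgroup (Equiv.Perm ℕ) where
  carrier := {w | {k | w k ≠ k}.Finite}
  one_mem' := by simp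
  mul_mem' := by
    intro u v hu hv
    refine (Set.Finite.union hu hv).subset ?_
    intro k hk
    by_contra h
    simp only [Set.mem_union, Set.mem_ofPred_eq, not_or, not_not] at h
    exact hk (by simp [Equiv.Perm.mul_apply, h.1, h.2])
  inv_mem' := by
    intro u hu
    refine Set.Finite.subset hu ?_
    intro k hk h
    exact hk (by rw [Equiv.Perm.inv_eq_iff_eq]; exact h.symm)

/-- The simple transposition exchanging `i` and `i + 1`, as an element of `S_∞`. -/
def s (i : ℕ) : SInf :=
  ⟨Equiv.swap i (i + 1), by
    refine Set.Finite.subset (Set.toFinite {i, i + 1}) ?_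
    intro k hk
    by_contra h
    simp only [Set.mem_insert_iff, Set.mem_singleton_iff, not_or] at h
    exact hk (Equiv.swap_apply_of_ne_of_ne h.1 h.2)⟩

/-- `w ∈ S_n`, where `S_n ⊆ S_∞` consists of the permutations fixing everything beyond the first
`n` indices. -/
def InSn (n : ℕ) (w : SInf) : Prop := ∀ k, n ≤ k → w.1 k = k

/-- `i` is a descent of `w`. -/
def IsDescent (w : SInf) (i : ℕ) : Prop := w.1 (i + 1) < w.1 i

instance (w : SInf) : DecidablePred (IsDescent w) :=
  fun i => inferInstanceAs (Decidable (w.1 (i + 1) < w.1 i))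

/-- `f` with the variables of index `i` and `i + 1` exchanged. -/
noncomputable def swapVars (i : ℕ) (f : Pol) : Pol :=
  MvPolynomial.rename (Equiv.swap i (i + 1)) f

theorem dvd_sub_swapVars (i : ℕ) (f : Pol) :
    (MvPolynomial.X i - MvPolynomial.X (i + 1) : Pol) ∣ f - swapVars i f := by
  induction f using MvPolynomial.induction_on with
  | C a => simp [swapVars]
  | add p q hp hq =>
    have : p + q - swapVars i (p + q) = (p - swapVars i p) + (q - swapVars i q) := by
      simp only [swapVars, map_add]; ring
    rw [this]
    exact dvd_add hp hq
  | mul_X p k hp =>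
    have h : p * MvPolynomial.X k - swapVars i (p * MvPolynomial.X k) =
        (p - swapVars i p) * MvPolynomial.X k +
        swapVars i p * (MvPolynomial.X k - MvPolynomial.X (Equiv.swap i (i + 1) k)) := by
      simp only [swapVars, map_mul, MvPolynomial.rename_X]; ring
    rw [h]
    refine dvd_add (Dvd.dvd.mul_right hp _) (Dvd.dvd.mul_left ?_ _)
    by_cases h1 : k = i
    · subst h1; simp
    · by_cases h2 : k = i + 1
      · subst h2
        rw [Equiv.swap_apply_right]
        exact ⟨-1, by ring⟩
      · rw [Equiv.swap_apply_of_ne_of_ne h1 h2]; simp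

/-- The divided difference `∂_i f = (f - s_i f) / (x_i - x_{i+1})`: the exact quotient. -/
noncomputable def dividedDiff (i : ℕ) (f : Pol) : Pol := (dvd_sub_swapVars i f).choose

theorem dividedDiff_spec (i : ℕ) (f : Pol) :
    (MvPolynomial.X i - MvPolynomial.X (i + 1)) * dividedDiff i f = f - swapVars i f :=
  (dvd_sub_swapVars i f).choose_spec.symm

/-- The defining properties of the Schubert polynomials: a family of homogeneous polynomials
indexed by `S_∞` with `𝔖_id = 1`, with `∂_i 𝔖_w = 𝔖_{w s_i}` if `i` is a descent of `w`, and with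
`∂_i 𝔖_w = 0` otherwise. -/
structure IsSchubertFamily (S : SInf → Pol) : Prop where
  homogeneous : ∀ w, ∃ d : ℕ, (S w).IsHomogeneous d
  one : S 1 = 1
  descent : ∀ w i, IsDescent w i → dividedDiff i (S w) = S (w * s i)
  ascent : ∀ w i, ¬ IsDescent w i → dividedDiff i (S w) = 0

/-- The Bergeron–Sottile map: substitute `0` for the variable of index `i` and let the later
variables move down one index, `f ↦ f(x_1, …, x_{i-1}, 0, x_i, x_{i+1}, …)`. -/
noncomputable def R (i : ℕ) : Pol →ₐ[ℤ] Pol :=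
  MvPolynomial.aeval fun k =>
    if k < i then MvPolynomial.X k else if k = i then 0 else MvPolynomial.X (k - 1)

/-- The cells (row, column) of the staircase of shape `(n, n-1, …, 1)`. -/
def stair (n : ℕ) : Finset (ℕ × ℕ) :=
  (Finset.range n ×ˢ Finset.range n).filter fun p => p.1 + p.2 < n

/-- The direction in which a pipe is heading: rightwards, or upwards. -/
inductive Dir
  | east
  | north

/-- A tiling of the staircase by crosses and elbows is given by the set `D` of cells carrying a
cross. `Enters n D i r c d` says that the pipe which starts at the left end of row `i` enters the
cell `(r, c)` of the staircase, through its left edge if `d` is `east`, and through its bottom edge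
if `d` is `north`. In a cross a pipe keeps its direction; an elbow tile joins its left edge to its
top edge, and its bottom edge to its right edge. -/
inductive Enters (n : ℕ) (D : Finset (ℕ × ℕ)) (i : ℕ) : ℕ → ℕ → Dir → Prop
  | start : i < n → Enters n D i i 0 Dir.east
  | cross_east (r c : ℕ) : Enters n D i r c Dir.east → (r, c) ∈ D → (r, c + 1) ∈ stair n →
      Enters n D i r (c + 1) Dir.east
  | cross_north (r c : ℕ) : Enters n D i (r + 1) c Dir.north → (r + 1, c) ∈ D →
      Enters n D i r c Dir.north
  | elbow_up (r c : ℕ) : Enters n D i (r + 1) c Dir.east → (r + 1, c) ∉ D →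
      Enters n D i r c Dir.north
  | elbow_right (r c : ℕ) : Enters n D i r c Dir.north → (r, c) ∉ D → (r, c + 1) ∈ stair n →
      Enters n D i r (c + 1) Dir.east

/-- Pipe `i` leaves the staircase through the top edge of column `c`. -/
def ExitsAt (n : ℕ) (D : Finset (ℕ × ℕ)) (i c : ℕ) : Prop :=
  (Enters n D i 0 c Dir.east ∧ (0, c) ∉ D) ∨ (Enters n D i 0 c Dir.north ∧ (0, c) ∈ D)

/-- Pipe `i` passes through the cell `p`. -/
def Passes (n : ℕ) (D : Finset (ℕ × ℕ)) (i : ℕ) (p : ℕ × ℕ) : Prop :=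
  ∃ d : Dir, Enters n D i p.1 p.2 d

/-- The tiling of the staircase with set of crosses `D` is a reduced pipe dream for `w ∈ S_n`: the
pipe entering in row `i` exits via column `w i`, and no two different pipes cross more than once. -/
structure IsPipeDream (n : ℕ) (w : SInf) (D : Finset (ℕ × ℕ)) : Prop where
  subset : D ⊆ stair n
  exits : ∀ i < n, ExitsAt n D i (w.1 i)
  reduced : ∀ i < n, ∀ j < n, i ≠ j → ∀ p ∈ D, ∀ q ∈ D,
    Passes n D i p → Passes n D j p → Passes n D i q → Passes n D j q → p = q

open Classical in
/-- `PD(w)` for `w ∈ S_n`; a pipe dream is recorded by its set of crosses. -/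
noncomputable def PD (n : ℕ) (w : SInf) : Finset (Finset (ℕ × ℕ)) :=
  (stair n).powerset.filter (IsPipeDream n w)

/-- `x^D`: the product over the crosses of `D` of the variable indexed by the row of the cross. -/
noncomputable def weight (D : Finset (ℕ × ℕ)) : Pol := ∏ p ∈ D, MvPolynomial.X p.1

/-- The generating polynomial of the pipe dreams for `w ∈ S_n`. -/
noncomputable def pdSum (n : ℕ) (w : SInf) : Pol := ∑ D ∈ PD n w, weight D

/-- `D` has no cross in the first column. -/
def Uncritical (D : Finset (ℕ × ℕ)) : Prop := ∀ p ∈ D, p.2 ≠ 0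

/-- The last (lowest) cross of `D` in the first column is in row `i`. -/
def Critical (i : ℕ) (D : Finset (ℕ × ℕ)) : Prop := (i, 0) ∈ D ∧ ∀ r, i < r → (r, 0) ∉ D

/-- `D` has no cross in row `i`. -/
def RowEmpty (i : ℕ) (D : Finset (ℕ × ℕ)) : Prop := ∀ p ∈ D, p.1 ≠ i

/-- The cell one step to the southwest (used for cells outside the first column). -/
def southwest (p : ℕ × ℕ) : ℕ × ℕ := (p.1 + 1, p.2 - 1)

/-- Shift all crosses one unit diagonally southwest. -/
def shiftAll (D : Finset (ℕ × ℕ)) : Finset (ℕ × ℕ) := D.image southwest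

/-- Turn the cross in row `i` of the first column into an elbow, then shift all crosses in rows `i`
and below one unit diagonally southwest. -/
def shiftFrom (i : ℕ) (D : Finset (ℕ × ℕ)) : Finset (ℕ × ℕ) :=
  (D.erase (i, 0)).image fun p => if i ≤ p.1 then southwest p else p

end Schubert

/-! Everything rests on the identity R_{i+1} f - R_i f = x_i R_i ∂_i f (`X_mul_R_dividedDiff`).
Since R_N f = f for large N, it telescopes to f = R_0 f + ∑ x_i R_i ∂_i f, so a Schubert family
satisfies S_w = R_0 S_w + ∑ x_i R_i S_{w s_i}, the sum running over the descents i of w. Iterating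
R_0 leaves only the constant term; hence this recursion and the constant terms determine the family,
by induction on length (`eq_of_sub_R_zero_eq`, `eq_pdSum_of_recursion`).

The pipe dream sums P_w obey the same recursion (`pdSum_recursion`), because R_i keeps only the pipe
dreams with row i empty, and the shifts match these with the pieces of PD(w) cut out by the position
of the lowest cross in the first column. That the shifts respect the permutation is seen on reduced
words: reading the rows from top to bottom and each from right to left, a cross at (r, c) giving
s_{r+c}, turns reduced pipe dreams into reduced words (`isPipeDream_iff_reading`). A southwest shift
preserves antidiagonals and reading order. The lowest cross (i, 0) of the first column gives a
letter s_i that commutes with all later letters, so erasing it replaces w by w s_i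
(`Critical.exists_reading`). Comparing recursions yields the formula and uniqueness.

For existence the P_w themselves are shown to be a Schubert family. By induction on length, the
polynomials g_i = P_{w s_i} (or 0 if i is not a descent) satisfy the nil-Coxeter relations among the
∂_i. Applying ∂_j to the recursion, for descending j, the terms with i < j and those with i > j + 1
telescope, the two remaining terms are handled by the braid relation (`dividedDiff_braid_sum`), and
the total is ∂_j P_w = g_j (`dividedDiff_eq_of_compatible`). -/

namespace Schubert
open MvPolynomial

/-! ### Divided differences and Bergeron–Sottile operators. -/

theorem X_sub_X_ne_zero (i : ℕ) : (X i - X (i + 1) : Pol) ≠ 0 :=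
  sub_ne_zero.2 fun h => by simpa using X_injective h

/-- The exact quotient is determined by its defining equation. -/
theorem dividedDiff_eq_of_mul_eq {i : ℕ} {f g : Pol}
    (h : (X i - X (i + 1)) * g = f - swapVars i f) : dividedDiff i f = g :=
  mul_left_cancel₀ (X_sub_X_ne_zero i) ((dividedDiff_spec i f).trans h.symm)

theorem swapVars_add (i : ℕ) (f g : Pol) : swapVars i (f + g) = swapVars i f + swapVars i g :=
  map_add _ _ _

theorem swapVars_sub (i : ℕ) (f g : Pol) : swapVars i (f - g) = swapVars i f - swapVars i g :=
  map_sub _ _ _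

theorem swapVars_mul (i : ℕ) (f g : Pol) : swapVars i (f * g) = swapVars i f * swapVars i g :=
  map_mul _ _ _

theorem swapVars_X (i k : ℕ) : swapVars i (X k) = X (Equiv.swap i (i + 1) k) := by
  simp [swapVars]

theorem swapVars_X_left (i : ℕ) : swapVars i (X i) = X (i + 1) := by simp [swapVars_X]

theorem swapVars_X_right (i : ℕ) : swapVars i (X (i + 1)) = X i := by simp [swapVars_X]

theorem swapVars_X_of_ne {i k : ℕ} (h : k ≠ i) (h' : k ≠ i + 1) : swapVars i (X k) = X k := by
  rw [swapVars_X, Equiv.swap_apply_of_ne_of_ne h h']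

theorem dividedDiff_zero (i : ℕ) : dividedDiff i 0 = 0 :=
  dividedDiff_eq_of_mul_eq (by simp [swapVars])

theorem dividedDiff_C (i : ℕ) (a : ℤ) : dividedDiff i (C a) = 0 :=
  dividedDiff_eq_of_mul_eq (by simp [swapVars])

theorem dividedDiff_add (i : ℕ) (f g : Pol) :
    dividedDiff i (f + g) = dividedDiff i f + dividedDiff i g := by
  apply dividedDiff_eq_of_mul_eq
  rw [mul_add, dividedDiff_spec, dividedDiff_spec, swapVars_add]
  ring

theorem dividedDiff_sum {ι : Type*} (i : ℕ) (t : Finset ι) (f : ι → Pol) :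
    dividedDiff i (∑ k ∈ t, f k) = ∑ k ∈ t, dividedDiff i (f k) :=
  map_sum (AddMonoidHom.mk' (dividedDiff i) (dividedDiff_add i)) f t

theorem dividedDiff_X_mul {i k : ℕ} (h : k ≠ i) (h' : k ≠ i + 1) (f : Pol) :
    dividedDiff i (X k * f) = X k * dividedDiff i f := by
  apply dividedDiff_eq_of_mul_eq
  rw [swapVars_mul, swapVars_X_of_ne h h', mul_left_comm, dividedDiff_spec]
  ring

theorem swapVars_of_dividedDiff_eq_zero {i : ℕ} {f : Pol} (h : dividedDiff i f = 0) :
    swapVars i f = f := by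
  have := dividedDiff_spec i f
  rw [h, mul_zero] at this
  exact (sub_eq_zero.1 this.symm).symm

theorem R_X (i k : ℕ) :
    R i (X k) = if k < i then X k else if k = i then 0 else X (k - 1) := by
  simp [R]

theorem R_X_of_lt {i k : ℕ} (h : k < i) : R i (X k) = X k := by simp [R_X, h]

theorem R_X_self (i : ℕ) : R i (X i) = 0 := by simp [R_X]

theorem R_X_succ {i k : ℕ} (h : i ≤ k) : R i (X (k + 1)) = X k := by
  rw [R_X, if_neg (by omega), if_neg (by omega), Nat.add_sub_cancel]

/-- The swap moves the inserted zero from slot `i` to slot `i + 1` and leaves the order of the other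
variables intact. -/
theorem R_swapVars (i : ℕ) (f : Pol) : R i (swapVars i f) = R (i + 1) f := by
  have h : (R i).comp (rename (Equiv.swap i (i + 1))) = R (i + 1) := algHom_ext fun k => by
    rw [AlgHom.comp_apply, rename_X, Equiv.swap_apply_def, R_X, R_X]
    split_ifs <;> first | omega | (congr 1 <;> omega)
  rw [swapVars, ← AlgHom.comp_apply, h]

theorem R_succ_swapVars (i : ℕ) (f : Pol) : R (i + 1) (swapVars i f) = R i f := by
  have h : (R (i + 1)).comp (rename (Equiv.swap i (i + 1))) = R i := algHom_ext fun k => by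
    rw [AlgHom.comp_apply, rename_X, Equiv.swap_apply_def, R_X, R_X]
    split_ifs <;> first | omega | (congr 1 <;> omega)
  rw [swapVars, ← AlgHom.comp_apply, h]

theorem swapVars_R_of_le {i j : ℕ} (h : i ≤ j) (f : Pol) :
    swapVars j (R i f) = R i (swapVars (j + 1) f) := by
  have h : (rename (Equiv.swap j (j + 1))).comp (R i) =
      (R i).comp (rename (Equiv.swap (j + 1) (j + 1 + 1))) := algHom_ext fun k => by
    rw [AlgHom.comp_apply, AlgHom.comp_apply, rename_X, R_X, R_X, apply_ite (rename _),
      apply_ite (rename _), map_zero, rename_X, rename_X]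
    simp only [Equiv.swap_apply_def]
    split_ifs <;> first | omega | congr 1
  rw [swapVars, swapVars, ← AlgHom.comp_apply, h, AlgHom.comp_apply]

theorem swapVars_R_of_lt {i j : ℕ} (h : j + 1 < i) (f : Pol) :
    swapVars j (R i f) = R i (swapVars j f) := by
  have h : (rename (Equiv.swap j (j + 1))).comp (R i) =
      (R i).comp (rename (Equiv.swap j (j + 1))) := algHom_ext fun k => by
    rw [AlgHom.comp_apply, AlgHom.comp_apply, rename_X, R_X, R_X, apply_ite (rename _),
      apply_ite (rename _), map_zero, rename_X, rename_X]
    simp only [Equiv.swap_apply_def]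
    split_ifs <;> first | omega | congr 1
  rw [swapVars, swapVars, ← AlgHom.comp_apply, h, AlgHom.comp_apply]

theorem dividedDiff_R_of_le {i j : ℕ} (h : i ≤ j) (f : Pol) :
    dividedDiff j (R i f) = R i (dividedDiff (j + 1) f) := by
  apply dividedDiff_eq_of_mul_eq
  rw [swapVars_R_of_le h, ← map_sub, ← dividedDiff_spec, map_mul, map_sub, R_X_succ h,
    R_X_succ (h.trans j.le_succ)]

theorem dividedDiff_R_of_lt {i j : ℕ} (h : j + 1 < i) (f : Pol) :
    dividedDiff j (R i f) = R i (dividedDiff j f) := by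
  apply dividedDiff_eq_of_mul_eq
  rw [swapVars_R_of_lt h, ← map_sub, ← dividedDiff_spec, map_mul, map_sub, R_X_of_lt h,
    R_X_of_lt (j.lt_succ_self.trans h)]

/-- The divided difference measures the difference of consecutive Bergeron–Sottile maps. -/
theorem X_mul_R_dividedDiff (i : ℕ) (f : Pol) :
    X i * R i (dividedDiff i f) = R (i + 1) f - R i f := by
  have h := congrArg (R i) (dividedDiff_spec i f)
  rw [map_mul, map_sub, map_sub, R_X_self, R_X_succ le_rfl, R_swapVars] at h
  linear_combination -h

theorem exists_R_eq_self (f : Pol) : ∃ N, ∀ m, N ≤ m → R m f = f := by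
  induction f using MvPolynomial.induction_on with
  | C a => exact ⟨0, fun m _ => by simp [R]⟩
  | add p q hp hq =>
    obtain ⟨M, hM⟩ := hp
    obtain ⟨N, hN⟩ := hq
    exact ⟨max M N, fun m hm => by
      rw [map_add, hM m ((le_max_left _ _).trans hm), hN m ((le_max_right _ _).trans hm)]⟩
  | mul_X p k hp =>
    obtain ⟨M, hM⟩ := hp
    exact ⟨max M (k + 1), fun m hm => by
      rw [map_mul, hM m ((le_max_left _ _).trans hm),
        R_X_of_lt (Nat.lt_of_succ_le ((le_max_right _ _).trans hm))]⟩

theorem exists_dividedDiff_eq_zero (f : Pol) : ∃ N, ∀ m, N ≤ m → dividedDiff m f = 0 := by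
  suffices h : ∃ N, ∀ m, N ≤ m → swapVars m f = f by
    obtain ⟨N, hN⟩ := h
    exact ⟨N, fun m hm => dividedDiff_eq_of_mul_eq (by rw [hN m hm]; ring)⟩
  induction f using MvPolynomial.induction_on with
  | C a => exact ⟨0, fun m _ => by simp [swapVars]⟩
  | add p q hp hq =>
    obtain ⟨M, hM⟩ := hp
    obtain ⟨N, hN⟩ := hq
    exact ⟨max M N, fun m hm => by
      rw [swapVars_add, hM m ((le_max_left _ _).trans hm), hN m ((le_max_right _ _).trans hm)]⟩
  | mul_X p k hp =>
    obtain ⟨M, hM⟩ := hp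
    exact ⟨max M (k + 1), fun m hm => by
      have := (le_max_right _ _).trans hm
      rw [swapVars_mul, hM m ((le_max_left _ _).trans hm),
        swapVars_X_of_ne (by omega) (by omega)]⟩

theorem sum_X_mul_R_dividedDiff (f : Pol) (N : ℕ) :
    ∑ i ∈ Finset.range N, X i * R i (dividedDiff i f) = R N f - R 0 f := by
  simp_rw [X_mul_R_dividedDiff]
  exact Finset.sum_range_sub (fun i => R i f) N

theorem exists_R_pow_eq_C (f : Pol) : ∃ N, ∀ m, N ≤ m → (R 0 ^ m) f = C (constantCoeff f) := by
  induction f using MvPolynomial.induction_on with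
  | C a =>
    refine ⟨0, fun m _ => ?_⟩
    rw [constantCoeff_C]
    exact (R 0 ^ m).commutes a
  | add p q hp hq =>
    obtain ⟨M, hM⟩ := hp
    obtain ⟨N, hN⟩ := hq
    exact ⟨max M N, fun m hm => by
      rw [map_add, hM m ((le_max_left _ _).trans hm), hN m ((le_max_right _ _).trans hm),
        map_add, map_add]⟩
  | mul_X p k hp =>
    refine ⟨k + 1, fun m hm => ?_⟩
    -- Each application of `R 0` lowers the index of a variable by one and finally kills it.
    have hX : ∀ k m, k + 1 ≤ m → (R 0 ^ m) (X k : Pol) = 0 := by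
      intro k
      induction k with
      | zero =>
        rintro (_ | m) hm
        · omega
        · rw [pow_succ, AlgHom.mul_apply, R_X_self, map_zero]
      | succ k ih =>
        rintro (_ | m) hm
        · omega
        · rw [pow_succ, AlgHom.mul_apply, R_X_succ k.zero_le, ih m (by omega)]
    rw [map_mul, hX k m hm]
    simp

/-- The only fixed points of `R 0` are the constants. -/
theorem eq_C_of_R_zero_eq_self {f : Pol} (h : R 0 f = f) : f = C (constantCoeff f) := by
  obtain ⟨N, hN⟩ := exists_R_pow_eq_C f
  rw [← hN N le_rfl]
  induction N with
  | zero => rfl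
  | succ N _ =>
    have : ∀ m, (R 0 ^ m) f = f := fun m => by
      induction m with
      | zero => rfl
      | succ m ih => rw [pow_succ, AlgHom.mul_apply, h, ih]
    exact (this _).symm

/-- The difference is fixed by `R 0`, hence constant, hence zero. This is the uniqueness principle
behind every comparison of recursions below. -/
theorem eq_of_sub_R_zero_eq {f g h : Pol} (hf : f = R 0 f + h) (hg : g = R 0 g + h)
    (h0 : constantCoeff f = constantCoeff g) : f = g := by
  have : R 0 (f - g) = f - g := by
    rw [map_sub]
    linear_combination hg - hf
  have := eq_C_of_R_zero_eq_self this
  rwa [map_sub, h0, sub_self, map_zero, sub_eq_zero] at this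

/-- The braid relation, evaluated where the third of the variables involved is zero. -/
theorem dividedDiff_braid_sum {j : ℕ} {p q : Pol} (hp : dividedDiff j p = 0)
    (hq : dividedDiff (j + 1) q = 0)
    (hpq : dividedDiff j (dividedDiff (j + 1) p) = dividedDiff (j + 1) (dividedDiff j q)) :
    dividedDiff j (X j * R j p) + dividedDiff j (X (j + 1) * R (j + 1) q) =
      R (j + 2) p - R j q := by
  rw [← dividedDiff_add]
  apply dividedDiff_eq_of_mul_eq
  have hp' := swapVars_of_dividedDiff_eq_zero hp
  have hq' := swapVars_of_dividedDiff_eq_zero hq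
  have e1 := dividedDiff_spec (j + 1) p
  have e2 := congrArg (swapVars j) e1
  have e3 := dividedDiff_spec j (dividedDiff (j + 1) p)
  have d1 := dividedDiff_spec j q
  have d2 := congrArg (swapVars (j + 1)) d1
  have d3 := dividedDiff_spec (j + 1) (dividedDiff j q)
  simp only [swapVars_mul, swapVars_sub, swapVars_X_left, swapVars_X_right, hp', hq'] at e2 d2
  rw [swapVars_X_of_ne (by omega) (by omega)] at e2 d2
  rw [← hpq] at d3
  -- The two sides are the two sides of `hpq` times the Vandermonde product of the three variables,
  -- expanded with the symmetries `hp'` and `hq'`.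
  have key : (X j - X (j + 1)) * p - (X j - X (j + 1 + 1)) * swapVars (j + 1) p
        + (X (j + 1) - X (j + 1 + 1)) * swapVars j (swapVars (j + 1) p) =
      (X (j + 1) - X (j + 1 + 1)) * q - (X j - X (j + 1 + 1)) * swapVars j q
        + (X j - X (j + 1)) * swapVars (j + 1) (swapVars j q) := by
    linear_combination (-(X j - X (j + 1 + 1)) * e1 + (X (j + 1) - X (j + 1 + 1)) * e2
      - (X (j + 1) - X (j + 1 + 1)) * (X j - X (j + 1 + 1)) * e3
      + (X j - X (j + 1 + 1)) * d1 - (X j - X (j + 1)) * d2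
      + (X j - X (j + 1)) * (X j - X (j + 1 + 1)) * d3)
  -- Setting the third variable to zero turns the remaining swaps into changes of the index of `R`.
  have hR := congrArg (R (j + 1 + 1)) key
  simp only [map_add, map_sub, map_mul, R_X_self, R_succ_swapVars] at hR
  rw [R_X_of_lt (show j < j + 1 + 1 by omega), R_X_of_lt (show j + 1 < j + 1 + 1 by omega),
    ← swapVars_R_of_lt (show j + 1 < j + 1 + 1 by omega),
    ← swapVars_R_of_lt (show j + 1 < j + 1 + 1 by omega), R_succ_swapVars] at hR
  have hp2 : R (j + 1) p = R j p := by rw [← R_succ_swapVars j p, hp']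
  have hq2 : R (j + 1 + 1) q = R (j + 1) q := by rw [← R_swapVars (j + 1) q, hq']
  rw [hp2, hq2] at hR
  simp only [swapVars_add, swapVars_mul, swapVars_X_left, swapVars_X_right]
  linear_combination hR

/-- A family `g` satisfying the nil-Coxeter compatibilities is the family of divided differences
of any solution `F` of the recursion built from it. -/
theorem dividedDiff_eq_of_compatible {F : Pol} {g : ℕ → Pol} {N : ℕ}
    (hg : ∀ i, N ≤ i → g i = 0)
    (hF : F = R 0 F + ∑ i ∈ Finset.range N, X i * R i (g i))
    (hsq : ∀ i, dividedDiff i (g i) = 0)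
    (hcomm : ∀ i j, i + 1 < j → dividedDiff i (g j) = dividedDiff j (g i))
    (hbraid : ∀ i, dividedDiff i (dividedDiff (i + 1) (g i)) =
      dividedDiff (i + 1) (dividedDiff i (g (i + 1)))) (j : ℕ) :
    dividedDiff j F = g j := by
  obtain ⟨A, hA⟩ := exists_dividedDiff_eq_zero F
  -- Descending induction on `j`: for large `j` both sides vanish.
  suffices h : ∀ k j, max A N ≤ j + k → dividedDiff j F = g j from
    h (max A N) j (Nat.le_add_left _ _)
  intro k
  induction k with
  | zero =>
    intro j hj
    rw [hA j ((le_max_left _ _).trans hj), hg j ((le_max_right _ _).trans hj)]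
  | succ k ih =>
    intro j hj
    obtain ⟨B, hB⟩ := exists_R_eq_self (g j)
    -- The range is enlarged so that the upper sum telescopes to an end where `R M` fixes `g j`.
    obtain ⟨M, hM⟩ : ∃ M, M = max B (max N (j + 2)) := ⟨_, rfl⟩
    have hsum : ∑ i ∈ Finset.range N, X i * R i (g i) =
        ∑ i ∈ Finset.range M, X i * R i (g i) := by
      refine Finset.sum_subset (Finset.range_mono (by omega)) fun i _ hi => ?_
      rw [hg i (by simpa using hi), map_zero, mul_zero]
    -- Commutation replaces `dividedDiff (j + 1) (g i)` by `dividedDiff i (g (j + 1))`, which makes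
    -- the sum telescope; `h2` does the same with `g j`.
    have h1 : ∑ i ∈ Finset.range j, dividedDiff j (X i * R i (g i)) =
        R j (g (j + 1)) - R 0 (g (j + 1)) := by
      rw [← sum_X_mul_R_dividedDiff]
      refine Finset.sum_congr rfl fun i hi => ?_
      have hi := Finset.mem_range.1 hi
      rw [dividedDiff_X_mul (by omega) (by omega), dividedDiff_R_of_le hi.le,
        hcomm i (j + 1) (by omega)]
    have h2 : ∑ i ∈ Finset.Ico (j + 2) M, dividedDiff j (X i * R i (g i)) =
        g j - R (j + 2) (g j) := by
      rw [← hB M (by omega)]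
      have e := Finset.sum_Ico_eq_sub (fun i => X i * R i (dividedDiff i (g j)))
        (show j + 2 ≤ M by omega)
      rw [sum_X_mul_R_dividedDiff, sum_X_mul_R_dividedDiff, hB M (by omega)] at e
      rw [hB M (by omega)]
      refine Eq.trans (Finset.sum_congr rfl fun i hi => ?_) (e.trans (by ring))
      have hi := (Finset.mem_Ico.1 hi).1
      rw [dividedDiff_X_mul (by omega) (by omega), dividedDiff_R_of_lt (by omega),
        hcomm j i (by omega)]
    rw [hF, dividedDiff_add, dividedDiff_R_of_le j.zero_le, ih (j + 1) (by omega), hsum,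
      dividedDiff_sum, ← Finset.sum_range_add_sum_Ico _ (show j + 2 ≤ M by omega),
      Finset.sum_range_succ, Finset.sum_range_succ, h1, h2, add_assoc (_ - _),
      dividedDiff_braid_sum (hsq j) (hsq (j + 1)) (hbraid j)]
    ring

end Schubert

/-! ### Coxeter length and descents. -/

namespace Schubert

/-- The inversions of `w`. -/
def inversions (w : SInf) : Set (ℕ × ℕ) := {p | p.1 < p.2 ∧ w.1 p.2 < w.1 p.1}

/-- The Coxeter length of `w`. -/
noncomputable def length (w : SInf) : ℕ := (inversions w).ncard

theorem exists_inSn (w : SInf) : ∃ n, InSn n w := by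
  obtain ⟨b, hb⟩ := w.2.bddAbove
  refine ⟨b + 1, fun k hk => ?_⟩
  by_contra h
  have : k ≤ b := hb h
  omega

theorem InSn.lt_iff {n : ℕ} {w : SInf} (h : InSn n w) (k : ℕ) : w.1 k < n ↔ k < n := by
  constructor
  · intro hk
    by_contra hn
    rw [h k (by omega)] at hk
    omega
  · intro hk
    by_contra hn
    have := w.1.injective (h (w.1 k) (by omega))
    omega

theorem IsDescent.succ_lt {n i : ℕ} {w : SInf} (h : InSn n w) (hi : IsDescent w i) :
    i + 1 < n := by
  have hi' : w.1 (i + 1) < w.1 i := hi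
  by_contra hn
  rw [h (i + 1) (by omega)] at hi'
  have := h.lt_iff i
  by_cases hin : i < n
  · have := this.2 hin
    omega
  · rw [h i (by omega)] at hi'
    omega

@[simp] theorem s_apply (i k : ℕ) : (s i).1 k = if k = i then i + 1 else if k = i + 1 then i else k :=
  Equiv.swap_apply_def _ _ _

@[simp] theorem coe_mul_apply (u v : SInf) (k : ℕ) : (u * v).1 k = u.1 (v.1 k) := rfl

theorem s_mul_self (i : ℕ) : s i * s i = 1 := Subtype.ext (Equiv.swap_mul_self _ _)

theorem mul_s_mul_s (w : SInf) (i : ℕ) : w * s i * s i = w := by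
  rw [mul_assoc, s_mul_self, mul_one]

theorem inSn_one (n : ℕ) : InSn n 1 := fun _ _ => rfl

theorem InSn.mul {n : ℕ} {u v : SInf} (hu : InSn n u) (hv : InSn n v) : InSn n (u * v) :=
  fun k hk => by rw [coe_mul_apply, hv k hk, hu k hk]

theorem inSn_s {n i : ℕ} (h : i + 1 < n) : InSn n (s i) := fun k hk => by
  rw [s_apply, if_neg (by omega), if_neg (by omega)]

theorem finite_inversions (w : SInf) : (inversions w).Finite := by
  obtain ⟨n, hn⟩ := exists_inSn w
  refine ((Set.finite_lt_nat n).prod (Set.finite_lt_nat n)).subset ?_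
  rintro ⟨a, b⟩ ⟨h1, h2⟩
  simp only at h1 h2
  suffices b < n from ⟨h1.trans this, this⟩
  by_contra hb
  rw [hn b (by omega)] at h2
  by_cases ha : a < n
  · have := (hn.lt_iff a).2 ha
    omega
  · rw [hn a (by omega)] at h2
    omega

theorem length_one : length 1 = 0 := by
  have : inversions 1 = ∅ := by
    ext ⟨a, b⟩
    simp only [inversions, Set.mem_ofPred_eq, Set.mem_empty_iff_false, iff_false]
    rintro ⟨h1, h2⟩
    exact absurd h1 (not_lt_of_gt h2)
  rw [length, this, Set.ncard_empty]

theorem length_inv (w : SInf) : length w⁻¹ = length w := by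
  have : inversions w⁻¹ = (Equiv.prodComm ℕ ℕ |>.trans (w.1.prodCongr w.1)) '' inversions w := by
    ext ⟨a, b⟩
    rw [Equiv.image_eq_preimage_symm]
    simp only [inversions, Set.mem_ofPred_eq, Set.mem_preimage]
    change a < b ∧ w.1.symm b < w.1.symm a ↔
      w.1.symm b < w.1.symm a ∧ w.1 (w.1.symm a) < w.1 (w.1.symm b)
    rw [Equiv.apply_symm_apply, Equiv.apply_symm_apply, and_comm]
  rw [length, this, Set.ncard_image_of_injective _ (Equiv.injective _), length]

/-- The map `s i` on positions carries the inversions of `w * s i` onto those of `w` other than `(i,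
i + 1)`. -/
theorem length_mul_s_of_isDescent {w : SInf} {i : ℕ} (h : IsDescent w i) :
    length w = length (w * s i) + 1 := by
  have h' : w.1 (i + 1) < w.1 i := h
  have hne : (i, i + 1) ∉ (((s i).1.prodCongr (s i).1) '' inversions (w * s i)) := by
    rintro ⟨⟨a, b⟩, ⟨h1, -⟩, h3⟩
    simp only [Equiv.prodCongr_apply, Prod.map_apply, Prod.mk.injEq, s_apply] at h1 h3
    obtain ⟨h3, h4⟩ := h3
    split_ifs at h3 h4 <;> omega
  have : inversions w = insert (i, i + 1) (((s i).1.prodCongr (s i).1) '' inversions (w * s i)) := by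
    ext ⟨a, b⟩
    rw [Set.mem_insert_iff, Equiv.image_eq_preimage_symm]
    simp only [inversions, Set.mem_ofPred_eq, Set.mem_preimage, Prod.mk.injEq]
    change a < b ∧ w.1 b < w.1 a ↔ (a = i ∧ b = i + 1) ∨ ((s i).1.symm a < (s i).1.symm b ∧
      w.1 ((s i).1 ((s i).1.symm b)) < w.1 ((s i).1 ((s i).1.symm a)))
    rw [Equiv.apply_symm_apply, Equiv.apply_symm_apply]
    have hs : (s i).1.symm = (s i).1 := Equiv.symm_swap _ _
    rw [hs, s_apply, s_apply]
    constructor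
    · rintro ⟨h1, h2⟩
      by_cases hab : a = i ∧ b = i + 1
      · exact Or.inl hab
      · exact Or.inr ⟨by split_ifs <;> omega, h2⟩
    · rintro (⟨rfl, rfl⟩ | ⟨h1, h2⟩)
      · exact ⟨Nat.lt_succ_self _, h'⟩
      · refine ⟨?_, h2⟩
        by_cases hab : b = i ∧ a = i + 1
        · rw [hab.1, hab.2] at h2
          exact absurd h2 (not_lt_of_gt h')
        · split_ifs at h1 <;> omega
  rw [length, this, Set.ncard_insert_of_notMem hne ((finite_inversions _).image _),
    Set.ncard_image_of_injective _ (Equiv.injective _), length]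

theorem apply_ne_apply_succ (w : SInf) (i : ℕ) : w.1 i ≠ w.1 (i + 1) :=
  fun h => i.succ_ne_self (w.1.injective h).symm

theorem isDescent_mul_s {w : SInf} {i : ℕ} : IsDescent (w * s i) i ↔ ¬ IsDescent w i := by
  have := apply_ne_apply_succ w i
  simp only [IsDescent, coe_mul_apply, s_apply]
  simp
  omega

theorem length_mul_s_of_not_isDescent {w : SInf} {i : ℕ} (h : ¬ IsDescent w i) :
    length (w * s i) = length w + 1 := by
  rw [length_mul_s_of_isDescent (isDescent_mul_s.2 h), mul_s_mul_s]

theorem s_inv (i : ℕ) : (s i)⁻¹ = s i := inv_eq_of_mul_eq_one_left (s_mul_self i)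

theorem length_s_mul_of_isDescent {w : SInf} {i : ℕ} (h : IsDescent w⁻¹ i) :
    length w = length (s i * w) + 1 := by
  rw [← length_inv w, length_mul_s_of_isDescent h, ← length_inv (s i * w), mul_inv_rev, s_inv]

theorem length_s_mul_of_not_isDescent {w : SInf} {i : ℕ} (h : ¬ IsDescent w⁻¹ i) :
    length (s i * w) = length w + 1 := by
  rw [← length_inv w, ← length_mul_s_of_not_isDescent h, ← length_inv (s i * w), mul_inv_rev, s_inv]

/-- Without descents both `w` and its inverse are increasing, so each lies above the identity. -/
theorem exists_isDescent {w : SInf} (h : w ≠ 1) : ∃ i, IsDescent w i := by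
  by_contra! hw
  have hmono : StrictMono w.1 := strictMono_nat_of_lt_succ fun k =>
    lt_of_le_of_ne (not_lt.1 (hw k)) (apply_ne_apply_succ w k)
  have hinv : StrictMono w.1.symm := fun a b hab => by
    rw [← hmono.lt_iff_lt, Equiv.apply_symm_apply, Equiv.apply_symm_apply]
    exact hab
  refine h (Subtype.ext (Equiv.ext fun k => le_antisymm ?_ hmono.le_apply))
  simpa using hinv.le_apply (x := w.1 k)

end Schubert

/-! ### Words and strands: reducedness means that no two strands meet twice. -/

namespace Schubert

/-- The permutation spelled by a list of cells, a cell on the antidiagonal `a` contributing `s a`. -/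
def word (L : List (ℕ × ℕ)) : SInf := (L.map fun p => s (p.1 + p.2)).prod

@[simp] theorem word_nil : word [] = 1 := rfl

@[simp] theorem word_cons (p : ℕ × ℕ) (L : List (ℕ × ℕ)) :
    word (p :: L) = s (p.1 + p.2) * word L := by
  simp [word]

@[simp] theorem word_append (L L' : List (ℕ × ℕ)) : word (L ++ L') = word L * word L' := by
  simp [word]

theorem word_apply_of_forall {L : List (ℕ × ℕ)} {k : ℕ}
    (h : ∀ p ∈ L, k ≠ p.1 + p.2 ∧ k ≠ p.1 + p.2 + 1) : (word L).1 k = k := by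
  induction L with
  | nil => rfl
  | cons p L ih =>
    rw [word_cons, coe_mul_apply, ih fun q hq => h q (List.mem_cons_of_mem _ hq), s_apply,
      if_neg (h p List.mem_cons_self).1, if_neg (h p List.mem_cons_self).2]

theorem inSn_word {n : ℕ} {L : List (ℕ × ℕ)} (h : ∀ p ∈ L, p.1 + p.2 + 1 < n) :
    InSn n (word L) := fun k hk =>
  word_apply_of_forall fun p hp => by
    have := h p hp
    omega

theorem length_word_le (L : List (ℕ × ℕ)) : length (word L) ≤ L.length := by
  induction L with
  | nil => simp [length_one]
  | cons p L ih =>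
    rw [word_cons, List.length_cons]
    by_cases h : IsDescent (word L)⁻¹ (p.1 + p.2)
    · have := length_s_mul_of_isDescent h
      omega
    · have := length_s_mul_of_not_isDescent h
      omega

/-- The strand starting at position `i` takes part in the exchange at the cell `p`, which is
performed after those in `L`. -/
def Meets (L : List (ℕ × ℕ)) (p : ℕ × ℕ) (i : ℕ) : Prop :=
  (word L).1 i = p.1 + p.2 ∨ (word L).1 i = p.1 + p.2 + 1

/-- The strand at position `a` is `(word L)⁻¹ a`. Each letter changes the length by one, so in a
reduced word every letter raises it, and it exchanges strands that are still in their initial order.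
-/
theorem length_word_of_cons {p : ℕ × ℕ} {L : List (ℕ × ℕ)}
    (h : length (word (p :: L)) = (p :: L).length) :
    length (word L) = L.length ∧ (word L)⁻¹.1 (p.1 + p.2) < (word L)⁻¹.1 (p.1 + p.2 + 1) := by
  have h1 := length_word_le L
  rw [word_cons, List.length_cons] at h
  by_cases hd : IsDescent (word L)⁻¹ (p.1 + p.2)
  · have := length_s_mul_of_isDescent hd
    omega
  · have := length_s_mul_of_not_isDescent hd
    exact ⟨by omega, lt_of_le_of_ne (not_lt.1 hd) (apply_ne_apply_succ _ _)⟩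

theorem inv_apply_eq_of_apply_eq {w : SInf} {i k : ℕ} (h : w.1 i = k) : w⁻¹.1 k = i := by
  rw [← h]
  exact w.1.symm_apply_apply i

theorem apply_inv_apply (w : SInf) (k : ℕ) : w.1 (w⁻¹.1 k) = k := w.1.apply_symm_apply k

/-- The relative order of two strands changes only at a letter that exchanges these two. -/
theorem exists_meets_of_inversion {L : List (ℕ × ℕ)} {i j : ℕ} (hij : i < j)
    (h : (word L).1 j < (word L).1 i) :
    ∃ B q C, L = B ++ q :: C ∧ Meets C q i ∧ Meets C q j := by
  induction L with
  | nil => exact absurd hij (not_lt_of_gt h)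
  | cons q L ih =>
    by_cases hL : (word L).1 j < (word L).1 i
    · obtain ⟨B, q', C, rfl, h1, h2⟩ := ih hL
      exact ⟨q :: B, q', C, rfl, h1, h2⟩
    · refine ⟨[], q, L, rfl, ?_⟩
      rw [word_cons, coe_mul_apply, coe_mul_apply, s_apply, s_apply] at h
      unfold Meets
      split_ifs at h <;> omega

/-- In a word that is not reduced some two strands meet twice. -/
theorem exists_meets_twice {L : List (ℕ × ℕ)} (h : length (word L) ≠ L.length) :
    ∃ A p B q C i j, L = A ++ p :: (B ++ q :: C) ∧ i ≠ j ∧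
      Meets (B ++ q :: C) p i ∧ Meets (B ++ q :: C) p j ∧ Meets C q i ∧ Meets C q j := by
  induction L with
  | nil => exact absurd length_one h
  | cons p L ih =>
    by_cases hL : length (word L) = L.length
    · have hd : IsDescent (word L)⁻¹ (p.1 + p.2) := by
        by_contra hd
        exact h (by rw [word_cons, length_s_mul_of_not_isDescent hd, hL, List.length_cons])
      have h1 := apply_inv_apply (word L) (p.1 + p.2)
      have h2 := apply_inv_apply (word L) (p.1 + p.2 + 1)
      -- The letter `p` lowers the length, so the strands it exchanges are already inverted and have
      -- met inside `L`.
      obtain ⟨B, q, C, rfl, h3, h4⟩ := exists_meets_of_inversion (L := L) hd (by rw [h1, h2]; omega)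
      exact ⟨[], p, B, q, C, _, _, rfl, ne_of_lt hd, Or.inr h2, Or.inl h1, h3, h4⟩
    · obtain ⟨A, p', B, q, C, i, j, rfl, h'⟩ := ih hL
      exact ⟨p :: A, p', B, q, C, i, j, rfl, h'⟩

theorem length_word_of_append {A L : List (ℕ × ℕ)}
    (h : length (word (A ++ L)) = (A ++ L).length) : length (word L) = L.length := by
  induction A with
  | nil => exact h
  | cons p A ih => exact ih (length_word_of_cons h).1

theorem Meets.apply_lt {L : List (ℕ × ℕ)} {p : ℕ × ℕ} {i j : ℕ}
    (h : length (word (p :: L)) = (p :: L).length) (hij : i < j)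
    (hi : Meets L p i) (hj : Meets L p j) : (word L).1 i < (word L).1 j := by
  by_contra hn
  have hne : (word L).1 i ≠ (word L).1 j := fun e => hij.ne ((word L).1.injective e)
  have hi' : (word L).1 i = p.1 + p.2 + 1 := by
    unfold Meets at hi hj
    omega
  have hj' : (word L).1 j = p.1 + p.2 := by
    unfold Meets at hj
    omega
  have := (length_word_of_cons h).2
  rw [inv_apply_eq_of_apply_eq hi', inv_apply_eq_of_apply_eq hj'] at this
  omega

/-- In a reduced word strands that have met are inverted for good. -/
theorem Meets.inversion {B C : List (ℕ × ℕ)} {q : ℕ × ℕ} {i j : ℕ}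
    (h : length (word (B ++ q :: C)) = (B ++ q :: C).length) (hij : i < j)
    (hi : Meets C q i) (hj : Meets C q j) :
    (word (B ++ q :: C)).1 j < (word (B ++ q :: C)).1 i := by
  induction B with
  | nil =>
    have := Meets.apply_lt h hij hi hj
    unfold Meets at hi hj
    rw [List.nil_append, word_cons, coe_mul_apply, coe_mul_apply, s_apply, s_apply]
    split_ifs <;> omega
  | cons p B ih =>
    rw [List.cons_append] at h ⊢
    have h' := ih (length_word_of_cons h).1
    have : ¬ (Meets (B ++ q :: C) p i ∧ Meets (B ++ q :: C) p j) := fun hm =>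
      (Meets.apply_lt h hij hm.1 hm.2).not_gt h'
    unfold Meets at this
    rw [word_cons, coe_mul_apply, coe_mul_apply, s_apply, s_apply]
    split_ifs <;> omega

/-- The earlier meeting inverts the strands for good, whereas strands about to meet in a reduced
word are not inverted. -/
theorem not_meets_twice {A B C : List (ℕ × ℕ)} {p q : ℕ × ℕ} {i j : ℕ}
    (h : length (word (A ++ p :: (B ++ q :: C))) = (A ++ p :: (B ++ q :: C)).length)
    (hij : i ≠ j) (h1 : Meets (B ++ q :: C) p i) (h2 : Meets (B ++ q :: C) p j)
    (h3 : Meets C q i) (h4 : Meets C q j) : False := by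
  have hp := length_word_of_append h
  have hq := (length_word_of_cons hp).1
  rcases lt_or_gt_of_ne hij with hij | hij
  · exact (Meets.apply_lt hp hij h1 h2).not_gt (Meets.inversion hq hij h3 h4)
  · exact (Meets.apply_lt hp hij h2 h1).not_gt (Meets.inversion hq hij h4 h3)

/-! ### Reading the crosses of a tiling as a word. -/

/-- The row reading order: rows from top to bottom, each from right to left. -/
def ReadBefore (p q : ℕ × ℕ) : Prop := p.1 < q.1 ∨ (p.1 = q.1 ∧ q.2 < p.2)

/-- The crosses in row `r` and in columns before `c`, from right to left. -/
def rowReading (D : Finset (ℕ × ℕ)) (r : ℕ) : ℕ → List (ℕ × ℕ)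
  | 0 => []
  | c + 1 => if (r, c) ∈ D then (r, c) :: rowReading D r c else rowReading D r c

/-- The crosses in the `k` rows from row `r` on and in the first `m` columns, in reading order. -/
def rowsReading (D : Finset (ℕ × ℕ)) (m : ℕ) : ℕ → ℕ → List (ℕ × ℕ)
  | _, 0 => []
  | r, k + 1 => rowReading D r m ++ rowsReading D m (r + 1) k

theorem mem_rowReading {D : Finset (ℕ × ℕ)} {r c : ℕ} {p : ℕ × ℕ} :
    p ∈ rowReading D r c ↔ p ∈ D ∧ p.1 = r ∧ p.2 < c := by
  obtain ⟨a, b⟩ := p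
  induction c with
  | zero => simp [rowReading]
  | succ c ih =>
    rw [rowReading]
    split_ifs with h
    · rw [List.mem_cons, ih, Prod.mk.injEq]
      constructor
      · rintro (⟨rfl, rfl⟩ | h)
        · exact ⟨h, rfl, Nat.lt_succ_self _⟩
        · exact ⟨h.1, h.2.1, by simp only at h ⊢; omega⟩
      · rintro ⟨h1, h2, h3⟩
        simp only at h2 h3 ⊢
        by_cases hb : b = c
        · exact Or.inl ⟨h2, hb⟩
        · exact Or.inr ⟨h1, h2, by omega⟩
    · rw [ih]
      constructor
      · rintro ⟨h1, h2, h3⟩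
        exact ⟨h1, h2, by omega⟩
      · rintro ⟨h1, h2, h3⟩
        simp only at h2 h3 ⊢
        subst h2
        refine ⟨h1, rfl, lt_of_le_of_ne (by omega) ?_⟩
        rintro rfl
        exact h h1

theorem mem_rowsReading {D : Finset (ℕ × ℕ)} {m r k : ℕ} {p : ℕ × ℕ} :
    p ∈ rowsReading D m r k ↔ p ∈ D ∧ r ≤ p.1 ∧ p.1 < r + k ∧ p.2 < m := by
  induction k generalizing r with
  | zero =>
    simp only [rowsReading, List.not_mem_nil, false_iff]
    omega
  | succ k ih =>
    rw [rowsReading, List.mem_append, ih, mem_rowReading]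
    constructor
    · rintro (⟨h1, h2, h3⟩ | ⟨h1, h2, h3, h4⟩)
      · exact ⟨h1, by omega, by omega, h3⟩
      · exact ⟨h1, by omega, by omega, h4⟩
    · rintro ⟨h1, h2, h3, h4⟩
      by_cases h : p.1 = r
      · exact Or.inl ⟨h1, h, h4⟩
      · exact Or.inr ⟨h1, by omega, by omega, h4⟩

theorem pairwise_rowReading (D : Finset (ℕ × ℕ)) (r c : ℕ) :
    (rowReading D r c).Pairwise ReadBefore := by
  induction c with
  | zero => exact List.Pairwise.nil
  | succ c ih =>
    rw [rowReading]
    split_ifs with h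
    · refine List.pairwise_cons.2 ⟨fun q hq => ?_, ih⟩
      obtain ⟨-, h2, h3⟩ := mem_rowReading.1 hq
      exact Or.inr ⟨h2.symm, h3⟩
    · exact ih

theorem pairwise_rowsReading (D : Finset (ℕ × ℕ)) (m r k : ℕ) :
    (rowsReading D m r k).Pairwise ReadBefore := by
  induction k generalizing r with
  | zero => exact List.Pairwise.nil
  | succ k ih =>
    refine List.pairwise_append.2 ⟨pairwise_rowReading D r m, ih (r + 1), fun p hp q hq => ?_⟩
    have h1 := (mem_rowReading.1 hp).2.1
    have h2 := (mem_rowsReading.1 hq).2.1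
    exact Or.inl (by omega)

/-- The crosses in the rows below `r`, and in row `r` before column `c`, in reading order. -/
def readingUpTo (n : ℕ) (D : Finset (ℕ × ℕ)) (r c : ℕ) : List (ℕ × ℕ) :=
  rowReading D r c ++ rowsReading D n (r + 1) (n - (r + 1))

/-- The crosses of `D` in reading order. -/
def reading (n : ℕ) (D : Finset (ℕ × ℕ)) : List (ℕ × ℕ) := readingUpTo n D 0 n

/-- The rearrangement of the strands by the crosses below row `r` and by those in row `r` before
column `c`. -/
def stateAt (n : ℕ) (D : Finset (ℕ × ℕ)) (r c : ℕ) : SInf := word (readingUpTo n D r c)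

theorem mem_readingUpTo {n : ℕ} {D : Finset (ℕ × ℕ)} {r c : ℕ} {p : ℕ × ℕ}
    (hp : p ∈ readingUpTo n D r c) : p ∈ D ∧ (r < p.1 ∨ p.1 = r ∧ p.2 < c) := by
  rcases List.mem_append.1 hp with h | h
  · have := mem_rowReading.1 h
    exact ⟨this.1, Or.inr this.2⟩
  · have := mem_rowsReading.1 h
    exact ⟨this.1, Or.inl (by omega)⟩

theorem pairwise_reading (n : ℕ) (D : Finset (ℕ × ℕ)) : (reading n D).Pairwise ReadBefore := by
  refine List.pairwise_append.2 ⟨pairwise_rowReading D 0 n, pairwise_rowsReading _ _ _ _,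
    fun p hp q hq => ?_⟩
  have h1 := (mem_rowReading.1 hp).2.1
  have h2 := (mem_rowsReading.1 hq).2.1
  exact Or.inl (by omega)

theorem mem_reading {n : ℕ} {D : Finset (ℕ × ℕ)} (hD : ∀ p ∈ D, p.1 < n ∧ p.2 < n) {p : ℕ × ℕ} :
    p ∈ reading n D ↔ p ∈ D := by
  refine ⟨fun h => (mem_readingUpTo h).1, fun h => List.mem_append.2 ?_⟩
  have := hD p h
  rw [mem_rowReading, mem_rowsReading]
  by_cases hp : p.1 = 0
  · exact Or.inl ⟨h, hp, this.2⟩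
  · exact Or.inr ⟨h, by omega, by omega, this.2⟩

theorem ReadBefore.ne {p q : ℕ × ℕ} (h : ReadBefore p q) : p ≠ q := by
  rintro rfl
  unfold ReadBefore at h
  omega

theorem nodup_reading (n : ℕ) (D : Finset (ℕ × ℕ)) : (reading n D).Nodup :=
  (pairwise_reading n D).imp ReadBefore.ne

theorem readingUpTo_succ_of_mem {n : ℕ} {D : Finset (ℕ × ℕ)} {r c : ℕ} (h : (r, c) ∈ D) :
    readingUpTo n D r (c + 1) = (r, c) :: readingUpTo n D r c := by
  rw [readingUpTo, rowReading, if_pos h, List.cons_append, readingUpTo]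

theorem readingUpTo_succ_of_notMem {n : ℕ} {D : Finset (ℕ × ℕ)} {r c : ℕ} (h : (r, c) ∉ D) :
    readingUpTo n D r (c + 1) = readingUpTo n D r c := by
  rw [readingUpTo, rowReading, if_neg h, readingUpTo]

theorem readingUpTo_zero {n : ℕ} (D : Finset (ℕ × ℕ)) {r : ℕ} (h : r + 1 < n) :
    readingUpTo n D r 0 = readingUpTo n D (r + 1) n := by
  rw [readingUpTo, readingUpTo, show n - (r + 1) = n - (r + 1 + 1) + 1 by omega]
  rfl

theorem exists_rowReading_eq_append (D : Finset (ℕ × ℕ)) (r : ℕ) {c c' : ℕ} (h : c ≤ c') :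
    ∃ A, rowReading D r c' = A ++ rowReading D r c ∧ ∀ p ∈ A, p.1 = r ∧ c ≤ p.2 := by
  induction c', h using Nat.le_induction with
  | base => exact ⟨[], rfl, by simp⟩
  | succ c' hc ih =>
    obtain ⟨A, hA, hA'⟩ := ih
    rw [rowReading]
    split_ifs
    · refine ⟨(r, c') :: A, by rw [hA]; rfl, fun p hp => ?_⟩
      rcases List.mem_cons.1 hp with rfl | hp
      · exact ⟨rfl, hc⟩
      · exact hA' p hp
    · exact ⟨A, hA, hA'⟩

theorem exists_reading_eq_append {n : ℕ} (D : Finset (ℕ × ℕ)) {r c : ℕ} (hr : r < n) (hc : c ≤ n) :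
    ∃ A, reading n D = A ++ readingUpTo n D r c := by
  have h0 : ∀ r c, c ≤ n → ∃ A, readingUpTo n D r n = A ++ readingUpTo n D r c := fun r c hc => by
    obtain ⟨A, hA, -⟩ := exists_rowReading_eq_append D r hc
    exact ⟨A, by rw [readingUpTo, hA, List.append_assoc, readingUpTo]⟩
  induction r generalizing c with
  | zero => exact h0 0 c hc
  | succ r ih =>
    obtain ⟨A, hA⟩ := ih (c := 0) (by omega) (Nat.zero_le _)
    obtain ⟨B, hB⟩ := h0 (r + 1) c hc
    exact ⟨A ++ B, by rw [hA, readingUpTo_zero D hr, hB, List.append_assoc]⟩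

/-- The part of the reading after a cross consists of the crosses processed before it. -/
theorem eq_readingUpTo_of_reading_eq {n : ℕ} {D : Finset (ℕ × ℕ)} {A B : List (ℕ × ℕ)}
    {p : ℕ × ℕ} (hp : p.1 < n ∧ p.2 < n) (h : reading n D = A ++ p :: B) :
    B = readingUpTo n D p.1 p.2 := by
  have hD : p ∈ D := (mem_readingUpTo (show p ∈ readingUpTo n D 0 n by
    rw [← reading, h]; simp)).1
  obtain ⟨A', hA'⟩ := exists_reading_eq_append D hp.1 (c := p.2 + 1) hp.2
  rw [readingUpTo_succ_of_mem hD] at hA'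
  have hn := nodup_reading n D
  have hn1 := hn
  rw [h] at hn
  rw [hA'] at hn1
  have e := h.symm.trans hA'
  have key : ∀ (A A' B B' : List (ℕ × ℕ)), (A ++ p :: B).Nodup → A ++ p :: B = A' ++ p :: B' →
      p ∉ A' → B = B' := by
    intro A
    induction A with
    | nil =>
      rintro (_ | ⟨a, A'⟩) B B' - h h'
      · simpa using h
      · simp only [List.nil_append, List.cons_append, List.cons.injEq] at h
        exact absurd (h.1 ▸ List.mem_cons_self) h'
    | cons a A ih =>
      rintro (_ | ⟨a', A'⟩) B B' hn h h'
      · simp only [List.nil_append, List.cons_append, List.cons.injEq] at h hn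
        rw [h.1] at hn
        exact absurd (List.mem_append_right _ List.mem_cons_self) (List.nodup_cons.1 hn).1
      · simp only [List.cons_append, List.cons.injEq] at h hn
        exact ih A' B B' (List.nodup_cons.1 hn).2 h.2 fun hm => h' (List.mem_cons_of_mem _ hm)
  exact key A A' B _ hn e fun hm => (List.nodup_append.1 hn1).2.2 p hm p List.mem_cons_self rfl

end Schubert

/-! ### Pipes as strands: reduced pipe dreams are reduced words. -/

namespace Schubert

theorem stateAt_succ_of_mem {n : ℕ} {D : Finset (ℕ × ℕ)} {r c : ℕ} (h : (r, c) ∈ D) (k : ℕ) :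
    (stateAt n D r (c + 1)).1 k = (s (r + c)).1 ((stateAt n D r c).1 k) := by
  rw [stateAt, readingUpTo_succ_of_mem h, word_cons]
  rfl

theorem stateAt_succ_of_notMem {n : ℕ} {D : Finset (ℕ × ℕ)} {r c : ℕ} (h : (r, c) ∉ D) :
    stateAt n D r (c + 1) = stateAt n D r c := by
  rw [stateAt, readingUpTo_succ_of_notMem h, stateAt]

theorem mul_apply_eq_iff {u v : SInf} {i k : ℕ} (h : u.1 k = k) :
    (u * v).1 i = k ↔ v.1 i = k := by
  rw [coe_mul_apply]
  constructor
  · intro h'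
    exact u.1.injective (h'.trans h.symm)
  · rintro h'
    rw [h', h]

/-- Positions to the left of a cell are not affected by the rest of its row. -/
theorem stateAt_apply_eq_iff {n : ℕ} {D : Finset (ℕ × ℕ)} {r c c' i k : ℕ} (h : c ≤ c')
    (hk : k < r + c) : (stateAt n D r c').1 i = k ↔ (stateAt n D r c).1 i = k := by
  obtain ⟨A, hA, hA'⟩ := exists_rowReading_eq_append D r h
  rw [stateAt, readingUpTo, hA, List.append_assoc, word_append]
  refine mul_apply_eq_iff (word_apply_of_forall fun p hp => ?_)
  have := hA' p hp
  omega

/-- Positions to the right of a cell are not affected by the earlier cells in its row. -/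
theorem stateAt_apply_eq_iff_zero {n : ℕ} {D : Finset (ℕ × ℕ)} {r c i k : ℕ} (hk : r + c < k) :
    (stateAt n D r c).1 i = k ↔ (stateAt n D r 0).1 i = k := by
  rw [stateAt, readingUpTo, word_append]
  refine mul_apply_eq_iff (word_apply_of_forall fun p hp => ?_)
  have := mem_rowReading.1 hp
  omega

/-- The top edge of `(r + 1, c)` is the bottom edge of `(r, c)`. Position `r + c + 1` is touched
neither by row `r + 1` beyond column `c` nor by row `r` before column `c`. -/
theorem stateAt_up {n : ℕ} {D : Finset (ℕ × ℕ)} {r c i : ℕ} (h : r + 1 + c < n) :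
    (stateAt n D r c).1 i = r + c + 1 ↔ (stateAt n D (r + 1) (c + 1)).1 i = r + c + 1 := by
  rw [stateAt_apply_eq_iff_zero (by omega), stateAt, readingUpTo_zero D (by omega), ← stateAt,
    stateAt_apply_eq_iff (show c + 1 ≤ n by omega) (by omega)]

theorem stateAt_start (n : ℕ) (D : Finset (ℕ × ℕ)) (r : ℕ) : (stateAt n D r 0).1 r = r :=
  word_apply_of_forall fun p hp => by
    have := (mem_readingUpTo hp).2
    omega

/-- The position of a strand relative to the antidiagonal of the cell it enters. -/
def Dir.offset : Dir → ℕ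
  | Dir.east => 0
  | Dir.north => 1

/-- The left edge of a cell on antidiagonal `a` carries position `a` and its bottom edge position `a
+ 1`; the right edge and the top edge carry `a + 1` and `a`. A cross exchanges the two strands and
an elbow leaves them in place, so pipes follow strands. -/
theorem Enters.stateAt_apply {n : ℕ} {D : Finset (ℕ × ℕ)} {i r c : ℕ} {d : Dir}
    (h : Enters n D i r c d) :
    r + c < n ∧ r ≤ i ∧ (stateAt n D r c).1 i = r + c + d.offset := by
  induction h with
  | start h => exact ⟨h, le_rfl, stateAt_start n D i⟩
  | cross_east r c _ hD hst ih =>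
    refine ⟨(Finset.mem_filter.1 hst).2, ih.2.1, ?_⟩
    rw [stateAt_succ_of_mem hD, ih.2.2, s_apply]
    simp [Dir.offset]
    omega
  | cross_north r c _ hD ih =>
    refine ⟨by omega, by omega, ?_⟩
    rw [Dir.offset, stateAt_up ih.1, stateAt_succ_of_mem hD, ih.2.2, s_apply]
    simp [Dir.offset]
    omega
  | elbow_up r c _ hD ih =>
    refine ⟨by omega, by omega, ?_⟩
    rw [Dir.offset, stateAt_up ih.1, stateAt_succ_of_notMem hD, ih.2.2]
    simp [Dir.offset]
    omega
  | elbow_right r c _ hD hst ih =>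
    refine ⟨(Finset.mem_filter.1 hst).2, ih.2.1, ?_⟩
    rw [stateAt_succ_of_notMem hD, ih.2.2]
    simp [Dir.offset]
    omega

theorem mem_stair {n : ℕ} {p : ℕ × ℕ} : p ∈ stair n ↔ p.1 + p.2 < n := by
  simp only [stair, Finset.mem_filter, Finset.mem_product, Finset.mem_range]
  omega

theorem eq_of_s_apply {a i k : ℕ} {w : SInf} (h : (s a).1 (w.1 i) = k) : w.1 i = (s a).1 k := by
  rw [← h, ← coe_mul_apply, s_mul_self]
  rfl

/-- If there are no crosses on the last antidiagonal below row `r`, then the pipes follow the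
strands up to row `r`. -/
theorem enters_of_stateAt {n : ℕ} {D : Finset (ℕ × ℕ)} {i r c : ℕ}
    (hD : ∀ p ∈ D, r < p.1 → p.1 + p.2 + 1 < n) (hc : r + c < n) :
    ((stateAt n D r c).1 i = r + c → Enters n D i r c Dir.east) ∧
    (r + c + 1 < n → (stateAt n D r c).1 i = r + c + 1 → Enters n D i r c Dir.north) := by
  obtain ⟨m, hm⟩ : ∃ m, c + 2 * (n - r) ≤ m := ⟨_, le_rfl⟩
  induction m generalizing r c with
  | zero => omega
  | succ m ih =>
    constructor
    · intro h
      rcases c with _ | c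
      · have : i = r := (stateAt n D r 0).1.injective (h.trans (stateAt_start n D r).symm)
        subst this
        exact Enters.start (by omega)
      · have ih' := ih hD (c := c) (by omega) (by omega)
        by_cases hrc : (r, c) ∈ D
        · rw [stateAt_succ_of_mem hrc] at h
          refine Enters.cross_east r c (ih'.1 ?_) hrc (mem_stair.2 hc)
          rw [eq_of_s_apply h, s_apply, if_neg (by omega), if_pos (by omega)]
        · rw [stateAt_succ_of_notMem hrc] at h
          exact Enters.elbow_right r c (ih'.2 (by omega) h) hrc (mem_stair.2 hc)
    · intro hc' h
      rw [stateAt_up (by omega)] at h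
      have ih' := ih (r := r + 1) (c := c) (fun p hp hr => hD p hp (by omega)) (by omega) (by omega)
      by_cases hrc : (r + 1, c) ∈ D
      · rw [stateAt_succ_of_mem hrc] at h
        refine Enters.cross_north r c (ih'.2 (hD _ hrc (Nat.lt_succ_self r)) ?_) hrc
        rw [eq_of_s_apply h, s_apply, if_pos (by omega)]
      · rw [stateAt_succ_of_notMem hrc] at h
        exact Enters.elbow_up r c (ih'.1 (by omega)) hrc

theorem ExitsAt.stateAt_apply {n : ℕ} {D : Finset (ℕ × ℕ)} {i c : ℕ} (h : ExitsAt n D i c) :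
    c < n ∧ (stateAt n D 0 n).1 i = c := by
  rcases h with ⟨h, hD⟩ | ⟨h, hD⟩
  · have h' := h.stateAt_apply
    refine ⟨by omega, ?_⟩
    rw [stateAt_apply_eq_iff (show c + 1 ≤ n by omega) (by omega), stateAt_succ_of_notMem hD,
      h'.2.2]
    simp [Dir.offset]
  · have h' := h.stateAt_apply
    refine ⟨by omega, ?_⟩
    rw [stateAt_apply_eq_iff (show c + 1 ≤ n by omega) (by omega), stateAt_succ_of_mem hD,
      h'.2.2, s_apply]
    simp [Dir.offset]

theorem exitsAt_of_stateAt {n : ℕ} {D : Finset (ℕ × ℕ)} {i c : ℕ}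
    (hD : ∀ p ∈ D, p.1 + p.2 + 1 < n) (hc : c < n) (h : (stateAt n D 0 n).1 i = c) :
    ExitsAt n D i c := by
  rw [stateAt_apply_eq_iff (show c + 1 ≤ n by omega) (by omega)] at h
  have he := enters_of_stateAt (i := i) (r := 0) (c := c) (fun p hp _ => hD p hp) (by omega)
  rw [zero_add] at he
  by_cases hrc : (0, c) ∈ D
  · rw [stateAt_succ_of_mem hrc] at h
    have := hD _ hrc
    refine Or.inr ⟨he.2 (by simpa using this) ?_, hrc⟩
    rw [eq_of_s_apply h, s_apply, if_pos (by omega), zero_add]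
  · rw [stateAt_succ_of_notMem hrc] at h
    exact Or.inl ⟨he.1 h, hrc⟩

/-- A pipe that reaches a cross on the last antidiagonal from the left does not get to a higher
row. -/
theorem Enters.le_of_stuck {n : ℕ} {D : Finset (ℕ × ℕ)} {i r c r' c' : ℕ} {d : Dir}
    (h : Enters n D i r c Dir.east) (hD : (r, c) ∈ D) (hc : r + c + 1 = n)
    (h' : Enters n D i r' c' d) : r ≤ r' := by
  have hst : (stateAt n D r (c + 1)).1 i = r + c + 1 := by
    rw [stateAt_succ_of_mem hD, h.stateAt_apply.2.2, s_apply]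
    simp [Dir.offset]
  have key : ∀ r' c', r ≤ r' + 1 → r' + 1 + c' < n → Enters n D i r' c' Dir.north → r ≤ r' := by
    intro r' c' hr hcc he
    by_contra hlt
    obtain rfl : r = r' + 1 := by omega
    have h2 := (stateAt_up hcc).1 he.stateAt_apply.2.2
    rw [← stateAt_apply_eq_iff (show c' + 1 ≤ c + 1 by omega) (by omega)] at h2
    omega
  induction h' with
  | start _ => exact h.stateAt_apply.2.1
  | cross_east r' c' _ _ _ ih => exact ih
  | cross_north r' c' h1 h2 ih => exact key _ _ ih h1.stateAt_apply.1 (Enters.cross_north r' c' h1 h2)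
  | elbow_up r' c' h1 h2 ih => exact key _ _ ih h1.stateAt_apply.1 (Enters.elbow_up r' c' h1 h2)
  | elbow_right r' c' _ _ _ ih => exact ih

open Classical in
theorem mem_pD {n : ℕ} {w : SInf} {D : Finset (ℕ × ℕ)} : D ∈ PD n w ↔ IsPipeDream n w D := by
  rw [PD, Finset.mem_filter, Finset.mem_powerset]
  exact ⟨And.right, fun h => ⟨h.subset, h⟩⟩

/-- A cross on the last antidiagonal would send the pipe coming from its left out of the staircase,
so that this pipe could not exit through the top. -/
theorem IsPipeDream.add_lt {n : ℕ} {w : SInf} {D : Finset (ℕ × ℕ)} (h : IsPipeDream n w D) :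
    ∀ p ∈ D, p.1 + p.2 + 1 < n := by
  by_contra! hn
  have hne : (D.filter fun p => n ≤ p.1 + p.2 + 1).Nonempty := by
    obtain ⟨p, hp⟩ := hn
    exact ⟨p, Finset.mem_filter.2 hp⟩
  -- With the lowest such cross, the rows below are free of them, and `enters_of_stateAt` puts an
  -- actual pipe on its left edge.
  obtain ⟨⟨r, c⟩, hmem, hmax⟩ := Finset.exists_max_image _ Prod.fst hne
  rw [Finset.mem_filter] at hmem
  have hst := mem_stair.1 (h.subset hmem.1)
  have hrc : r + c + 1 = n := by
    have := hmem.2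
    simp only at this hst
    omega
  have hlow : ∀ p ∈ D, r < p.1 → p.1 + p.2 + 1 < n := by
    intro p hp hr
    by_contra hpn
    exact (hmax p (Finset.mem_filter.2 ⟨hp, by omega⟩)).not_gt hr
  have hin : InSn n (stateAt n D r c) := inSn_word fun p hp => by
    obtain ⟨h1, h2 | h2⟩ := mem_readingUpTo hp
    · exact hlow p h1 h2
    · omega
  have happ := apply_inv_apply (stateAt n D r c) (r + c)
  have hi := (hin.lt_iff _).1 (show (stateAt n D r c).1 ((stateAt n D r c)⁻¹.1 (r + c)) < n by omega)
  have he := (enters_of_stateAt hlow (by omega)).1 happ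
  have hex := h.exits _ hi
  have hr : r = 0 := by
    rcases hex with hex | hex <;>
    exact Nat.le_zero.1 (he.le_of_stuck hmem.1 hrc hex.1)
  subst hr
  have h1 := hex.stateAt_apply
  have h2 := he.stateAt_apply.2.2
  -- In row `0` the cross sits in the top right corner and moves the strand to position `n`, which
  -- is not an exit column.
  obtain rfl : n = c + 1 := by omega
  rw [stateAt_succ_of_mem hmem.1, h2, s_apply] at h1
  simp [Dir.offset] at h1
  omega

theorem Passes.meets {n : ℕ} {D : Finset (ℕ × ℕ)} {i : ℕ} {p : ℕ × ℕ} (h : Passes n D i p) :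
    Meets (readingUpTo n D p.1 p.2) p i := by
  obtain ⟨d, hd⟩ := h
  have := hd.stateAt_apply.2.2
  cases d
  · exact Or.inl this
  · exact Or.inr this

theorem Meets.passes {n : ℕ} {D : Finset (ℕ × ℕ)} {i : ℕ} {p : ℕ × ℕ}
    (hD : ∀ p ∈ D, p.1 + p.2 + 1 < n) (hp : p.1 + p.2 + 1 < n)
    (h : Meets (readingUpTo n D p.1 p.2) p i) : Passes n D i p := by
  have he := enters_of_stateAt (i := i) (fun q hq (_ : p.1 < q.1) => hD q hq)
    (show p.1 + p.2 < n by omega)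
  rcases h with h | h
  · exact ⟨_, he.1 h⟩
  · exact ⟨_, he.2 hp h⟩

theorem Meets.lt {n : ℕ} {L : List (ℕ × ℕ)} {i : ℕ} {p : ℕ × ℕ}
    (hL : ∀ p ∈ L, p.1 + p.2 + 1 < n) (hp : p.1 + p.2 + 1 < n) (h : Meets L p i) : i < n := by
  rw [← (inSn_word hL).lt_iff]
  unfold Meets at h
  omega

/-- A set of crosses is a reduced pipe dream for `w` exactly if its reading is a reduced word of
`w` in the first `n - 1` simple transpositions. -/
theorem isPipeDream_iff_reading {n : ℕ} {w : SInf} {D : Finset (ℕ × ℕ)} (hw : InSn n w) :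
    IsPipeDream n w D ↔ (∀ p ∈ D, p.1 + p.2 + 1 < n) ∧ word (reading n D) = w ∧
      (reading n D).length = length w := by
  constructor
  · intro h
    have hD := h.add_lt
    have hR : ∀ p ∈ reading n D, p ∈ D ∧ p.1 + p.2 + 1 < n := fun p hp =>
      ⟨(mem_readingUpTo hp).1, hD p (mem_readingUpTo hp).1⟩
    have hword : word (reading n D) = w := by
      refine Subtype.ext (Equiv.ext fun i => ?_)
      by_cases hi : i < n
      · exact (h.exits i hi).stateAt_apply.2
      · rw [hw i (by omega), inSn_word (fun p hp => (hR p hp).2) i (by omega)]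
    refine ⟨hD, hword, ?_⟩
    rw [← hword]
    by_contra hlen
    -- If the reading were not reduced, two pipes would share two crosses, at different cells since
    -- the reading has no repetitions.
    obtain ⟨A, p, B, q, C, i, j, hL, hij, h1, h2, h3, h4⟩ := exists_meets_twice (Ne.symm hlen)
    have hL' : reading n D = (A ++ p :: B) ++ q :: C := by
      rw [hL, List.append_assoc, List.cons_append]
    have hp := hR p (by rw [hL]; simp)
    have hq := hR q (by rw [hL]; simp)
    have hC : ∀ x ∈ C, x.1 + x.2 + 1 < n := fun x hx => (hR x (by rw [hL]; simp [hx])).2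
    have eB := eq_readingUpTo_of_reading_eq (p := p) ⟨by omega, by omega⟩ hL
    have eC := eq_readingUpTo_of_reading_eq (p := q) ⟨by omega, by omega⟩ hL'
    have hi := h3.lt hC hq.2
    have hj := h4.lt hC hq.2
    rw [eB] at h1 h2
    rw [eC] at h3 h4
    have hpq := h.reduced i hi j hj hij p hp.1 q hq.1 (h1.passes hD hp.2) (h2.passes hD hp.2)
      (h3.passes hD hq.2) (h4.passes hD hq.2)
    have hn := nodup_reading n D
    rw [hL, hpq] at hn
    have := (List.nodup_append.1 hn).2.1
    simp at this
  · rintro ⟨hD, hword, hlen⟩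
    rw [← hword] at hlen
    have hmem : ∀ p ∈ D, p ∈ reading n D := fun p hp =>
      (mem_reading fun q hq => by
        have := hD q hq
        omega).2 hp
    have key : ∀ p ∈ D, ∀ q ∈ D, ∀ i j, i ≠ j → q ∈ readingUpTo n D p.1 p.2 →
        Passes n D i p → Passes n D j p → Passes n D i q → Passes n D j q → False := by
      intro p hp q hq i j hij hqp h1 h2 h3 h4
      have hpn := hD p hp
      have hqn := hD q hq
      obtain ⟨A, B, hL⟩ := List.append_of_mem (hmem p hp)
      have eB := eq_readingUpTo_of_reading_eq (p := p) ⟨by omega, by omega⟩ hL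
      obtain ⟨B', C, hB⟩ := List.append_of_mem hqp
      rw [← eB] at hB
      have eC := eq_readingUpTo_of_reading_eq (n := n) (D := D) (A := A ++ p :: B') (B := C) (p := q)
        ⟨by omega, by omega⟩ (by rw [hL, hB, List.append_assoc, List.cons_append])
      have h1 := h1.meets
      have h2 := h2.meets
      have h3 := h3.meets
      have h4 := h4.meets
      rw [← eB, hB] at h1 h2
      rw [← eC] at h3 h4
      rw [hL, hB] at hlen
      exact not_meets_twice hlen.symm hij h1 h2 h3 h4
    refine ⟨fun p hp => mem_stair.2 ?_, fun i hi => ?_, ?_⟩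
    · have := hD p hp
      omega
    · refine exitsAt_of_stateAt hD ((hw.lt_iff i).2 hi) ?_
      rw [← hword]
      rfl
    · intro i _ j _ hij p hp q hq h1 h2 h3 h4
      by_contra hpq
      obtain ⟨A, B, hL⟩ := List.append_of_mem (hmem p hp)
      have hpn := hD p hp
      have hqn := hD q hq
      have eB := eq_readingUpTo_of_reading_eq (p := p) ⟨by omega, by omega⟩ hL
      have hqm := hmem q hq
      rw [hL, List.mem_append, List.mem_cons] at hqm
      rcases hqm with hqm | hqm | hqm
      · obtain ⟨A', B', hA⟩ := List.append_of_mem hqm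
        have eB' := eq_readingUpTo_of_reading_eq (n := n) (D := D) (A := A') (B := B' ++ p :: B) (p := q)
          ⟨by omega, by omega⟩ (by rw [hL, hA, List.append_assoc, List.cons_append])
        exact key q hq p hp i j hij (by rw [← eB']; simp) h3 h4 h1 h2
      · exact hpq hqm.symm
      · exact key p hp q hq i j hij (by rw [← eB]; exact hqm) h1 h2 h3 h4

/-- Any listing of the crosses in reading order is the reading. -/
theorem eq_reading {n : ℕ} {D : Finset (ℕ × ℕ)} {L : List (ℕ × ℕ)}
    (hD : ∀ p ∈ D, p.1 + p.2 + 1 < n) (hL : L.Pairwise ReadBefore) (hLD : ∀ p, p ∈ L ↔ p ∈ D) :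
    L = reading n D := by
  refine List.Perm.eq_of_pairwise (le := ReadBefore) (fun a b _ _ h1 h2 => ?_) hL
    (pairwise_reading n D) ((List.perm_ext_iff_of_nodup (hL.imp ReadBefore.ne)
      (nodup_reading n D)).2 fun p => ?_)
  · unfold ReadBefore at h1 h2
    omega
  · rw [hLD, mem_reading fun q hq => by
      have := hD q hq
      omega]

theorem exists_reading (D : Finset (ℕ × ℕ)) :
    ∃ L : List (ℕ × ℕ), L.Pairwise ReadBefore ∧ ∀ p, p ∈ L ↔ p ∈ D := by
  obtain ⟨a, ha⟩ := (D.image Prod.fst).finite_toSet.bddAbove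
  obtain ⟨b, hb⟩ := (D.image Prod.snd).finite_toSet.bddAbove
  refine ⟨reading (a + b + 1) D, pairwise_reading _ _, fun p => mem_reading fun q hq => ?_⟩
  have h1 : q.1 ≤ a := ha (by simpa using ⟨_, hq⟩)
  have h2 : q.2 ≤ b := hb (by simpa using ⟨_, hq⟩)
  omega

theorem isPipeDream_iff {n : ℕ} {w : SInf} {D : Finset (ℕ × ℕ)} (hw : InSn n w)
    {L : List (ℕ × ℕ)} (hL : L.Pairwise ReadBefore) (hLD : ∀ p, p ∈ L ↔ p ∈ D) :
    IsPipeDream n w D ↔ (∀ p ∈ D, p.1 + p.2 + 1 < n) ∧ word L = w ∧ L.length = length w := by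
  rw [isPipeDream_iff_reading hw]
  refine and_congr_right fun hD => ?_
  rw [eq_reading hD hL hLD]

theorem IsPipeDream.card_eq {n : ℕ} {w : SInf} {D : Finset (ℕ × ℕ)} (hw : InSn n w)
    (h : IsPipeDream n w D) : D.card = length w := by
  obtain ⟨L, hL, hLD⟩ := exists_reading D
  rw [← ((isPipeDream_iff hw hL hLD).1 h).2.2,
    ← List.toFinset_card_of_nodup (hL.imp ReadBefore.ne)]
  congr 1
  ext p
  rw [List.mem_toFinset, hLD]

theorem isPipeDream_empty_iff {n : ℕ} {w : SInf} (hw : InSn n w) :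
    IsPipeDream n w ∅ ↔ w = 1 := by
  rw [isPipeDream_iff hw (L := []) List.Pairwise.nil (by simp)]
  constructor
  · exact fun h => h.2.1.symm
  · rintro rfl
    simp [length_one]

end Schubert

/-! ### The shift bijections and the recursion for pipe dream sums. -/

namespace Schubert
open MvPolynomial

theorem southwest_injOn : Set.InjOn southwest {p | p.2 ≠ 0} := by
  rintro ⟨a, b⟩ h1 ⟨c, d⟩ h2 h
  simp only [southwest, Prod.mk.injEq, Set.mem_ofPred_eq] at h h1 h2
  exact Prod.ext (by simp only; omega) (by simp only; omega)

/-- Only the later cell must avoid column `0`: within a row the earlier cell lies further right, so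
truncated subtraction keeps the strict inequality. -/
theorem ReadBefore.southwest {p q : ℕ × ℕ} (hq : q.2 ≠ 0) (h : ReadBefore p q) :
    ReadBefore (southwest p) (southwest q) := by
  unfold ReadBefore at *
  simp only [Schubert.southwest]
  omega

theorem word_map {f : ℕ × ℕ → ℕ × ℕ} {L : List (ℕ × ℕ)}
    (h : ∀ p ∈ L, (f p).1 + (f p).2 = p.1 + p.2) : word (L.map f) = word L := by
  unfold word
  rw [List.map_map]
  congr 1
  exact List.map_congr_left fun p hp => congrArg s (h p hp)

/-- Shifting along antidiagonals, compatibly with the reading order, does not change the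
permutation of a pipe dream. -/
theorem isPipeDream_image_iff {n : ℕ} {w : SInf} (hw : InSn n w) {D : Finset (ℕ × ℕ)}
    {f : ℕ × ℕ → ℕ × ℕ} (hf : ∀ p ∈ D, (f p).1 + (f p).2 = p.1 + p.2)
    (hord : ∀ p ∈ D, ∀ q ∈ D, ReadBefore p q → ReadBefore (f p) (f q)) :
    IsPipeDream n w (D.image f) ↔ IsPipeDream n w D := by
  obtain ⟨L, hL, hLD⟩ := exists_reading D
  rw [isPipeDream_iff hw hL hLD, isPipeDream_iff hw (L := L.map f)
    (List.pairwise_map.2 (hL.imp_of_mem fun {p q} hp hq =>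
      hord p ((hLD p).1 hp) q ((hLD q).1 hq))) (fun p => by simp [hLD]),
    word_map (fun p hp => hf p ((hLD p).1 hp)), List.length_map, Finset.forall_mem_image]
  refine and_congr_left fun _ => forall₂_congr fun p hp => ?_
  rw [hf p hp]

theorem southwest_add {p : ℕ × ℕ} (h : p.2 ≠ 0) :
    (southwest p).1 + (southwest p).2 = p.1 + p.2 := by
  simp only [southwest]
  omega

theorem isPipeDream_shiftAll_iff {n : ℕ} {w : SInf} (hw : InSn n w) {D : Finset (ℕ × ℕ)}
    (hD : Uncritical D) : IsPipeDream n w (shiftAll D) ↔ IsPipeDream n w D :=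
  isPipeDream_image_iff hw (fun p hp => southwest_add (hD p hp))
    fun _ _ q hq h => h.southwest (hD q hq)

theorem finset_image_inj_of_injOn {α β : Type*} [DecidableEq β] {f : α → β} {s : Set α} (hf : Set.InjOn f s)
    {A B : Finset α} (hA : ↑A ⊆ s) (hB : ↑B ⊆ s) (h : A.image f = B.image f) : A = B := by
  rw [← Finset.coe_inj, ← hf.image_eq_image_iff hA hB, ← Finset.coe_image, ← Finset.coe_image, h]

theorem bijOn_shiftAll {n : ℕ} {w : SInf} (hw : InSn n w) :
    Set.BijOn shiftAll {D | D ∈ PD n w ∧ Uncritical D} {D | D ∈ PD n w ∧ RowEmpty 0 D} := by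
  refine ⟨?_, ?_, ?_⟩
  · rintro D ⟨hD, hu⟩
    refine ⟨mem_pD.2 ((isPipeDream_shiftAll_iff hw hu).2 (mem_pD.1 hD)), ?_⟩
    intro p hp
    obtain ⟨q, -, rfl⟩ := Finset.mem_image.1 hp
    exact Nat.succ_ne_zero _
  · rintro A ⟨-, hA⟩ B ⟨-, hB⟩ h
    exact finset_image_inj_of_injOn southwest_injOn hA hB h
  · rintro D ⟨hD, he⟩
    -- The inverse shift goes northeast; its truncated subtraction is harmless because row `0` is
    -- empty.
    have hu : Uncritical (D.image fun p => (p.1 - 1, p.2 + 1)) := fun p hp => by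
      obtain ⟨q, -, rfl⟩ := Finset.mem_image.1 hp
      exact Nat.succ_ne_zero _
    have himg : shiftAll (D.image fun p => (p.1 - 1, p.2 + 1)) = D := by
      rw [shiftAll, Finset.image_image]
      refine (Finset.image_congr fun p hp => ?_).trans Finset.image_id
      have := he p hp
      exact Prod.ext (by simp [southwest]; omega) (by simp [southwest])
    refine ⟨_, ⟨mem_pD.2 ?_, hu⟩, himg⟩
    rw [← isPipeDream_shiftAll_iff hw hu, himg]
    exact mem_pD.1 hD

theorem weight_eq_R_weight_shiftAll {D : Finset (ℕ × ℕ)} (hD : Uncritical D) :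
    weight D = R 0 (weight (shiftAll D)) := by
  rw [weight, weight, shiftAll, Finset.prod_image (southwest_injOn.mono hD), map_prod]
  exact Finset.prod_congr rfl fun p _ => (R_X_succ (Nat.zero_le _)).symm

/-- The motion of a single cross in `shiftFrom i`. -/
def shiftCell (i : ℕ) (p : ℕ × ℕ) : ℕ × ℕ := if i ≤ p.1 then southwest p else p

theorem shiftFrom_eq (i : ℕ) (D : Finset (ℕ × ℕ)) :
    shiftFrom i D = (D.erase (i, 0)).image (shiftCell i) := rfl

theorem Critical.col_ne_zero {i : ℕ} {D : Finset (ℕ × ℕ)} (hD : Critical i D) {p : ℕ × ℕ}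
    (hp : p ∈ D.erase (i, 0)) (hi : i ≤ p.1) : p.2 ≠ 0 := by
  obtain ⟨a, b⟩ := p
  rintro rfl
  rw [Finset.mem_erase] at hp
  rcases eq_or_lt_of_le hi with rfl | hlt
  · exact hp.1 rfl
  · exact hD.2 a hlt hp.2

theorem shiftCell_add {i : ℕ} {p : ℕ × ℕ} (h : i ≤ p.1 → p.2 ≠ 0) :
    (shiftCell i p).1 + (shiftCell i p).2 = p.1 + p.2 := by
  unfold shiftCell
  split_ifs with hi
  · exact southwest_add (h hi)
  · rfl

theorem ReadBefore.shiftCell {i : ℕ} {p q : ℕ × ℕ}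
    (hq : i ≤ q.1 → q.2 ≠ 0) (h : ReadBefore p q) :
    ReadBefore (shiftCell i p) (shiftCell i q) := by
  unfold ReadBefore at *
  simp only [Schubert.shiftCell]
  split_ifs <;> (try simp only [Schubert.southwest]) <;> omega

theorem shiftCell_injOn (i : ℕ) : Set.InjOn (shiftCell i) {p | i ≤ p.1 → p.2 ≠ 0} := by
  rintro ⟨a, b⟩ h1 ⟨c, d⟩ h2 h
  simp only [Set.mem_ofPred_eq] at h1 h2
  simp only [shiftCell, southwest] at h
  split_ifs at h <;> rw [Prod.mk.injEq] at h ⊢ <;> omega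

theorem s_mul_word_comm {i : ℕ} {L : List (ℕ × ℕ)} (h : ∀ p ∈ L, i + 1 < p.1 + p.2) :
    s i * word L = word L * s i := by
  induction L with
  | nil => simp
  | cons p L ih =>
    have hp := h p List.mem_cons_self
    have hcomm : s i * s (p.1 + p.2) = s (p.1 + p.2) * s i :=
      Subtype.ext (Equiv.ext fun k => by
        simp only [coe_mul_apply, s_apply]
        split_ifs <;> omega)
    rw [word_cons, ← mul_assoc, hcomm, mul_assoc, ih fun q hq => h q (List.mem_cons_of_mem _ hq),
      mul_assoc]

/-- The reading of a pipe dream and that of its shift, which omits one letter. -/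
theorem Critical.exists_reading {i : ℕ} {D : Finset (ℕ × ℕ)} (hD : Critical i D) :
    ∃ L L' : List (ℕ × ℕ), L.Pairwise ReadBefore ∧ (∀ p, p ∈ L ↔ p ∈ D) ∧
      L'.Pairwise ReadBefore ∧ (∀ p, p ∈ L' ↔ p ∈ shiftFrom i D) ∧
      word L = word L' * s i ∧ L.length = L'.length + 1 := by
  obtain ⟨L, hL, hLD⟩ := Schubert.exists_reading D
  obtain ⟨u, v, rfl⟩ := List.append_of_mem ((hLD _).2 hD.1)
  have hL1 := List.pairwise_append.1 hL
  have hL2 := List.pairwise_cons.1 hL1.2.1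
  have hsub : ∀ p, p ∈ u ++ v ↔ p ∈ D.erase (i, 0) := by
    intro p
    rw [Finset.mem_erase, ← hLD, List.mem_append, List.mem_append, List.mem_cons]
    constructor
    · rintro (h | h)
      · exact ⟨(hL1.2.2 p h _ List.mem_cons_self).ne, Or.inl h⟩
      · exact ⟨(hL2.1 p h).ne.symm, Or.inr (Or.inr h)⟩
    · rintro ⟨h1, h | h | h⟩
      · exact Or.inl h
      · exact absurd h h1
      · exact Or.inr h
  have hcol : ∀ p ∈ u ++ v, i ≤ p.1 → p.2 ≠ 0 := fun p hp => hD.col_ne_zero ((hsub p).1 hp)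
  have hpair : (u ++ v).Pairwise ReadBefore :=
    hL.sublist (List.Sublist.append_left (List.sublist_cons_self _ _) u)
  refine ⟨_, (u ++ v).map (Schubert.shiftCell i), hL, hLD, List.pairwise_map.2
    (hpair.imp_of_mem fun _ hq h => h.shiftCell (hcol _ hq)), fun p => ?_, ?_, ?_⟩
  · simp only [shiftFrom_eq, List.mem_map, Finset.mem_image, hsub]
  -- The crosses in `v` lie below row `i` and outside column `0`, hence on antidiagonals at least `i
  -- + 2`; so `s i` moves past them to the right end.
  · rw [word_map fun p hp => shiftCell_add (hcol p hp), word_append, word_append, word_cons,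
      mul_assoc, ← s_mul_word_comm (i := i), add_zero]
    intro p hp
    have h1 := hL2.1 p hp
    have h2 := hcol p (List.mem_append_right _ hp)
    simp only [ReadBefore] at h1
    omega
  · simp only [List.length_append, List.length_cons, List.length_map]
    omega

/-- The shifted word spells `w * s i` with one letter fewer than the length of `w`, which excludes
an ascent at `i`. -/
theorem Critical.isDescent {n i : ℕ} {w : SInf} {D : Finset (ℕ × ℕ)} (hw : InSn n w)
    (hD : Critical i D) (h : IsPipeDream n w D) : IsDescent w i := by
  obtain ⟨L, L', hL, hLD, -, -, hword, hlen⟩ := hD.exists_reading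
  have h' := ((isPipeDream_iff hw hL hLD).1 h).2
  by_contra hd
  have h1 := length_mul_s_of_not_isDescent hd
  rw [← h'.1, hword, mul_s_mul_s, ← hword, h'.1] at h1
  have := length_word_le L'
  omega

theorem Critical.isPipeDream_shiftFrom_iff {n i : ℕ} {w : SInf} {D : Finset (ℕ × ℕ)}
    (hw : InSn n w) (hi : IsDescent w i) (hD : Critical i D) :
    IsPipeDream n (w * s i) (shiftFrom i D) ↔ IsPipeDream n w D := by
  have hin := hi.succ_lt hw
  obtain ⟨L, L', hL, hLD, hL', hLD', hword, hlen⟩ := hD.exists_reading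
  rw [isPipeDream_iff (hw.mul (inSn_s hin)) hL' hLD', isPipeDream_iff hw hL hLD, hword,
    shiftFrom_eq, Finset.forall_mem_image, hlen, length_mul_s_of_isDescent hi]
  refine and_congr ?_ (and_congr ?_ (by omega))
  · constructor
    · intro h p hp
      by_cases hpi : p = (i, 0)
      · rw [hpi]
        simpa using hin
      · have hpe := Finset.mem_erase.2 ⟨hpi, hp⟩
        rw [← shiftCell_add (i := i) (hD.col_ne_zero hpe)]
        exact h hpe
    · intro h p hp
      rw [shiftCell_add (hD.col_ne_zero hp)]
      exact h p (Finset.mem_of_mem_erase hp)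
  · constructor
    · intro h
      rw [h, mul_s_mul_s]
    · intro h
      rw [← h, mul_s_mul_s]

theorem Critical.rowEmpty_shiftFrom {i : ℕ} (D : Finset (ℕ × ℕ)) :
    RowEmpty i (shiftFrom i D) := by
  intro p hp
  rw [shiftFrom_eq] at hp
  obtain ⟨q, -, rfl⟩ := Finset.mem_image.1 hp
  simp only [shiftCell]
  split_ifs <;> (try simp only [southwest]) <;> omega

theorem exists_shiftFrom_eq {i : ℕ} {D : Finset (ℕ × ℕ)} (hD : RowEmpty i D) :
    ∃ D', Critical i D' ∧ shiftFrom i D' = D := by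
  let g : ℕ × ℕ → ℕ × ℕ := fun p => if i < p.1 then (p.1 - 1, p.2 + 1) else p
  -- As row `i` is empty, a cross either stays above row `i` or is moved northeast, out of column
  -- `0`; hence the added cross at `(i, 0)` is the lowest in that column.
  have hg : ∀ p ∈ D, ∀ r, i ≤ r → g p ≠ (r, 0) := by
    intro p hp r hr h
    have := hD p hp
    simp only [g] at h
    split_ifs at h with h1
    · simp at h
    · rw [h] at h1 this
      simp only at h1 this
      omega
  have hnot : (i, 0) ∉ D.image g := fun h => by
    obtain ⟨p, hp, h⟩ := Finset.mem_image.1 h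
    exact hg p hp i le_rfl h
  refine ⟨insert (i, 0) (D.image g), ⟨Finset.mem_insert_self _ _, fun r hr h => ?_⟩, ?_⟩
  · rcases Finset.mem_insert.1 h with h | h
    · rw [Prod.mk.injEq] at h
      omega
    · obtain ⟨p, hp, h⟩ := Finset.mem_image.1 h
      exact hg p hp r hr.le h
  · rw [shiftFrom_eq, Finset.erase_insert hnot, Finset.image_image]
    refine (Finset.image_congr fun p hp => ?_).trans Finset.image_id
    have := hD p hp
    obtain ⟨a, b⟩ := p
    simp only [Function.comp_apply, g, shiftCell, southwest, id]
    simp only at this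
    split_ifs <;> simp only [Prod.mk.injEq] at * <;> omega

theorem bijOn_shiftFrom {n i : ℕ} {w : SInf} (hw : InSn n w) (hi : IsDescent w i) :
    Set.BijOn (shiftFrom i) {D | D ∈ PD n w ∧ Critical i D}
      {D | D ∈ PD n (w * s i) ∧ RowEmpty i D} := by
  refine ⟨?_, ?_, ?_⟩
  · rintro D ⟨hD, hc⟩
    exact ⟨mem_pD.2 ((hc.isPipeDream_shiftFrom_iff hw hi).2 (mem_pD.1 hD)),
      Critical.rowEmpty_shiftFrom D⟩
  · rintro A ⟨-, hA⟩ B ⟨-, hB⟩ h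
    have := finset_image_inj_of_injOn (shiftCell_injOn i) (fun p hp => hA.col_ne_zero hp)
      (fun p hp => hB.col_ne_zero hp) h
    rw [← Finset.insert_erase hA.1, this, Finset.insert_erase hB.1]
  · rintro D ⟨hD, he⟩
    obtain ⟨D', hc, rfl⟩ := exists_shiftFrom_eq he
    exact ⟨D', ⟨mem_pD.2 ((hc.isPipeDream_shiftFrom_iff hw hi).1 (mem_pD.1 hD)), hc⟩, rfl⟩

theorem weight_eq_X_mul_R_weight_shiftFrom {i : ℕ} {D : Finset (ℕ × ℕ)} (hD : Critical i D) :
    weight D = X i * R i (weight (shiftFrom i D)) := by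
  rw [weight, weight, shiftFrom_eq, ← Finset.mul_prod_erase D _ hD.1,
    Finset.prod_image ((shiftCell_injOn i).mono fun p hp => hD.col_ne_zero hp), map_prod]
  congr 1
  refine Finset.prod_congr rfl fun p _ => ?_
  unfold shiftCell southwest
  split_ifs with h
  · exact (R_X_succ h).symm
  · exact (R_X_of_lt (not_le.1 h)).symm

theorem R_weight_of_not_rowEmpty {i : ℕ} {D : Finset (ℕ × ℕ)} (h : ¬ RowEmpty i D) :
    R i (weight D) = 0 := by
  simp only [RowEmpty, not_forall, not_not] at h
  obtain ⟨p, hp, rfl⟩ := h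
  rw [weight, map_prod]
  exact Finset.prod_eq_zero hp (R_X_self _)

open Classical in
theorem R_pdSum (i n : ℕ) (w : SInf) :
    R i (pdSum n w) = ∑ D ∈ PD n w with RowEmpty i D, R i (weight D) := by
  rw [pdSum, map_sum, Finset.sum_filter]
  refine Finset.sum_congr rfl fun D _ => ?_
  split_ifs with h
  · rfl
  · exact R_weight_of_not_rowEmpty h

theorem exists_critical {D : Finset (ℕ × ℕ)} (h : ¬ Uncritical D) : ∃ i, Critical i D := by
  have hne : (D.filter fun p => p.2 = 0).Nonempty := by
    simp only [Uncritical, not_forall, not_not] at h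
    obtain ⟨p, hp, h0⟩ := h
    exact ⟨p, Finset.mem_filter.2 ⟨hp, h0⟩⟩
  obtain ⟨⟨r, c⟩, hmem, hmax⟩ := Finset.exists_max_image _ Prod.fst hne
  rw [Finset.mem_filter] at hmem
  obtain ⟨h1, rfl : c = 0⟩ := hmem
  exact ⟨r, h1, fun r' hr hr' => (hmax (r', 0) (Finset.mem_filter.2 ⟨hr', rfl⟩)).not_gt hr⟩

theorem Critical.eq {i j : ℕ} {D : Finset (ℕ × ℕ)} (hi : Critical i D) (hj : Critical j D) :
    i = j := by
  by_contra h
  rcases lt_or_gt_of_ne h with h | h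
  · exact hi.2 j h hj.1
  · exact hj.2 i h hi.1

open Classical in
theorem pdSum_recursion {n : ℕ} {w : SInf} (hw : InSn n w) :
    pdSum n w = R 0 (pdSum n w) +
      ∑ i ∈ (Finset.range n).filter (fun i => IsDescent w i),
        X i * R i (pdSum n (w * s i)) := by
  have h0 : R 0 (pdSum n w) = ∑ D ∈ PD n w with Uncritical D, weight D := by
    rw [R_pdSum]
    have hb := bijOn_shiftAll hw
    refine (Finset.sum_nbij shiftAll (fun D hD => ?_) ?_ ?_ fun D hD => ?_).symm
    · exact Finset.mem_filter.2 (hb.mapsTo (Finset.mem_filter.1 hD))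
    · simpa only [Finset.coe_filter] using hb.injOn
    · simpa only [Finset.coe_filter] using hb.surjOn
    · exact weight_eq_R_weight_shiftAll (Finset.mem_filter.1 hD).2
  have h1 : ∀ i ∈ (Finset.range n).filter (fun i => IsDescent w i),
      X i * R i (pdSum n (w * s i)) = ∑ D ∈ PD n w with Critical i D, weight D := by
    intro i hi
    rw [R_pdSum, Finset.mul_sum]
    have hb := bijOn_shiftFrom hw (Finset.mem_filter.1 hi).2
    refine (Finset.sum_nbij (shiftFrom i) (fun D hD => ?_) ?_ ?_ fun D hD => ?_).symm
    · exact Finset.mem_filter.2 (hb.mapsTo (Finset.mem_filter.1 hD))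
    · simpa only [Finset.coe_filter] using hb.injOn
    · simpa only [Finset.coe_filter] using hb.surjOn
    · exact weight_eq_X_mul_R_weight_shiftFrom (Finset.mem_filter.1 hD).2
  rw [h0, Finset.sum_congr rfl h1, pdSum]
  -- After exchanging the sums it remains to see that each pipe dream is counted once: it is
  -- uncritical, or critical for exactly one row, which is a descent.
  simp_rw [Finset.sum_filter (Critical _)]
  rw [Finset.sum_comm, Finset.sum_filter, ← Finset.sum_add_distrib]
  refine Finset.sum_congr rfl fun D hD => ?_
  by_cases hu : Uncritical D
  · rw [if_pos hu, Finset.sum_eq_zero fun i _ => if_neg fun hc : Critical i D => hu _ hc.1 rfl,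
      add_zero]
  · obtain ⟨j, hj⟩ := exists_critical hu
    have hd := hj.isDescent hw (mem_pD.1 hD)
    rw [if_neg hu, zero_add, Finset.sum_eq_single_of_mem j
      (Finset.mem_filter.2 ⟨Finset.mem_range.2 (Nat.lt_of_succ_lt (hd.succ_lt hw)), hd⟩)
      fun i _ hij => if_neg fun hi : Critical i D => hij (hi.eq hj), if_pos hj]

end Schubert

/-! ### Comparison of pipe dream sums with Schubert polynomials. -/

namespace Schubert
open MvPolynomial

theorem weight_isHomogeneous (D : Finset (ℕ × ℕ)) : (weight D).IsHomogeneous D.card := by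
  rw [Finset.card_eq_sum_ones]
  exact IsHomogeneous.prod D _ _ fun p _ => isHomogeneous_X ℤ p.1

theorem pdSum_isHomogeneous {n : ℕ} {w : SInf} (hw : InSn n w) :
    (pdSum n w).IsHomogeneous (length w) :=
  IsHomogeneous.sum _ _ _ fun D hD => (mem_pD.1 hD).card_eq hw ▸ weight_isHomogeneous D

theorem constantCoeff_weight (D : Finset (ℕ × ℕ)) :
    constantCoeff (weight D) = if D = ∅ then 1 else 0 := by
  split_ifs with h
  · rw [h, weight, Finset.prod_empty, map_one]
  · obtain ⟨p, hp⟩ := Finset.nonempty_iff_ne_empty.2 h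
    rw [weight, map_prod]
    exact Finset.prod_eq_zero hp (constantCoeff_X ℤ p.1)

theorem constantCoeff_pdSum {n : ℕ} {w : SInf} (hw : InSn n w) [Decidable (w = 1)] :
    constantCoeff (pdSum n w) = if w = 1 then 1 else 0 := by
  rw [pdSum, map_sum]
  simp_rw [constantCoeff_weight]
  rw [Finset.sum_ite_eq']
  exact if_congr (mem_pD.trans (isPipeDream_empty_iff hw)) rfl rfl

/-- The recursion, summed over an arbitrary range that contains the descents. -/
theorem pdSum_recursion_of_le {n N : ℕ} {w : SInf} (hw : InSn n w) (h : n ≤ N) :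
    pdSum n w = R 0 (pdSum n w) + ∑ i ∈ Finset.range N,
      X i * R i (if IsDescent w i then pdSum n (w * s i) else 0) := by
  refine (pdSum_recursion hw).trans (congrArg _ ?_)
  rw [Finset.sum_filter]
  refine Eq.trans (Finset.sum_congr rfl fun i _ => ?_)
    (Finset.sum_subset (Finset.range_mono h) fun i _ hi => ?_)
  · split_ifs <;> simp
  · rw [if_neg fun hd : IsDescent w i => hi (Finset.mem_range.2
      (Nat.lt_of_succ_lt (hd.succ_lt hw))), map_zero, mul_zero]

open Classical in
/-- A family that satisfies the recursion is the family of generating polynomials of pipe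
dreams. -/
theorem eq_pdSum_of_recursion {S : SInf → Pol}
    (h0 : ∀ w, constantCoeff (S w) = if w = 1 then 1 else 0)
    (hS : ∀ w, ∃ M, ∀ N, M ≤ N → S w = R 0 (S w) + ∑ i ∈ Finset.range N,
      X i * R i (if IsDescent w i then S (w * s i) else 0))
    {n : ℕ} {w : SInf} (hw : InSn n w) : S w = pdSum n w := by
  induction hl : length w using Nat.strong_induction_on generalizing w with
  | _ l ih =>
    obtain ⟨M, hM⟩ := hS w
    refine eq_of_sub_R_zero_eq (hM (max M n) (le_max_left _ _))
      ((pdSum_recursion_of_le hw (le_max_right M n)).trans (congrArg _ ?_)) ?_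
    · refine Finset.sum_congr rfl fun i _ => ?_
      split_ifs with hd
      · have := length_mul_s_of_isDescent hd
        rw [ih (length (w * s i)) (by omega) (hw.mul (inSn_s (hd.succ_lt hw))) rfl]
      · rfl
    · rw [h0, constantCoeff_pdSum hw]

/-- Up to vanishing terms the recursion does not involve the size of the staircase, so induction on
length removes the dependence on it. -/
theorem pdSum_eq_pdSum {m n : ℕ} {w : SInf} (hm : InSn m w) (hn : InSn n w) :
    pdSum m w = pdSum n w := by
  classical
  induction hl : length w using Nat.strong_induction_on generalizing w with
  | _ l ih =>
    refine eq_of_sub_R_zero_eq (pdSum_recursion_of_le hm (le_max_left m n))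
      ((pdSum_recursion_of_le hn (le_max_right m n)).trans (congrArg _ ?_)) ?_
    · refine Finset.sum_congr rfl fun i _ => ?_
      split_ifs with hd
      · have := length_mul_s_of_isDescent hd
        rw [ih (length (w * s i)) (by omega) (hm.mul (inSn_s (hd.succ_lt hm)))
          (hn.mul (inSn_s (hd.succ_lt hn))) rfl]
      · rfl
    · rw [constantCoeff_pdSum hm, constantCoeff_pdSum hn]

namespace IsSchubertFamily

theorem dividedDiff_eq {S : SInf → Pol} (hS : IsSchubertFamily S) (w : SInf) (i : ℕ) :
    dividedDiff i (S w) = if IsDescent w i then S (w * s i) else 0 := by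
  split_ifs with h
  · exact hS.descent w i h
  · exact hS.ascent w i h

/-- Divided differences at successive descents lead from `S w` down to `S 1 = 1`. -/
theorem ne_zero {S : SInf → Pol} (hS : IsSchubertFamily S) (w : SInf) : S w ≠ 0 := by
  induction hl : length w using Nat.strong_induction_on generalizing w with
  | _ l ih =>
    by_cases hw : w = 1
    · rw [hw, hS.one]
      exact one_ne_zero
    · obtain ⟨i, hi⟩ := exists_isDescent hw
      have := length_mul_s_of_isDescent hi
      intro h0
      refine ih _ (by omega) (w * s i) rfl ?_
      rw [← hS.descent w i hi, h0, dividedDiff_zero]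

/-- By homogeneity, a nonzero constant term would make `S w` constant; a divided difference at a
descent would then vanish, contrary to `ne_zero`. -/
theorem constantCoeff_eq {S : SInf → Pol} (hS : IsSchubertFamily S) (w : SInf)
    [Decidable (w = 1)] : constantCoeff (S w) = if w = 1 then 1 else 0 := by
  split_ifs with hw
  · rw [hw, hS.one, map_one]
  · obtain ⟨i, hi⟩ := exists_isDescent hw
    obtain ⟨d, hd⟩ := hS.homogeneous w
    by_contra h0
    obtain rfl : d = 0 := by
      by_contra hd0
      exact h0 (hd.coeff_eq_zero (by simpa using Ne.symm hd0))
    refine hS.ne_zero (w * s i) ?_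
    rw [← hS.descent w i hi, totalDegree_eq_zero_iff_eq_C.1
      (Nat.le_zero.1 hd.totalDegree_le), dividedDiff_C]

theorem eq_pdSum {S : SInf → Pol} (hS : IsSchubertFamily S) {n : ℕ} {w : SInf}
    (hw : InSn n w) : S w = pdSum n w := by
  classical
  refine eq_pdSum_of_recursion (fun w => hS.constantCoeff_eq w) (fun w => ?_) hw
  obtain ⟨M, hM⟩ := exists_R_eq_self (S w)
  refine ⟨M, fun N hN => ?_⟩
  simp_rw [← hS.dividedDiff_eq]
  rw [sum_X_mul_R_dividedDiff, hM N hN]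
  ring

end IsSchubertFamily

/-- The generating polynomial of the pipe dreams for `w` in any symmetric group containing `w`. -/
noncomputable def pipeDreamPoly (w : SInf) : Pol := pdSum (exists_inSn w).choose w

theorem pipeDreamPoly_eq {n : ℕ} {w : SInf} (hw : InSn n w) : pipeDreamPoly w = pdSum n w :=
  pdSum_eq_pdSum (exists_inSn w).choose_spec hw

theorem dividedDiff_pipeDreamPoly (w : SInf) (j : ℕ) :
    dividedDiff j (pipeDreamPoly w) =
      if IsDescent w j then pipeDreamPoly (w * s j) else 0 := by
  induction hl : length w using Nat.strong_induction_on generalizing w j with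
  | _ l ih =>
    obtain ⟨n, hn⟩ := exists_inSn w
    have ih' : ∀ i, IsDescent w i → ∀ j, dividedDiff j (pipeDreamPoly (w * s i)) =
        if IsDescent (w * s i) j then pipeDreamPoly (w * s i * s j) else 0 := fun i hi j => by
      have := length_mul_s_of_isDescent hi
      exact ih _ (by omega) (w * s i) j rfl
    refine dividedDiff_eq_of_compatible (N := n)
      (g := fun j => if IsDescent w j then pipeDreamPoly (w * s j) else 0) (fun i hi => ?_) ?_
      (fun i => ?_) (fun i j hij => ?_) (fun i => ?_) j
    · refine if_neg fun hd : IsDescent w i => ?_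
      have := hd.succ_lt hn
      omega
    · rw [pipeDreamPoly_eq hn]
      refine (pdSum_recursion_of_le hn le_rfl).trans (congrArg _ (Finset.sum_congr rfl fun i _ => ?_))
      split_ifs with hd
      · rw [pipeDreamPoly_eq (hn.mul (inSn_s (hd.succ_lt hn)))]
      · rfl
    · split_ifs with hd
      · rw [ih' i hd, if_neg (isDescent_mul_s.not.2 (not_not.2 hd))]
      · exact dividedDiff_zero i
    · have hcomm : s i * s j = s j * s i := Subtype.ext (Equiv.ext fun k => by
        simp only [coe_mul_apply, s_apply]
        split_ifs <;> omega)
      have hij' : IsDescent (w * s i) j ↔ IsDescent w j := by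
        simp only [IsDescent, coe_mul_apply, s_apply]
        rw [if_neg (by omega), if_neg (by omega), if_neg (by omega), if_neg (by omega)]
      have hji' : IsDescent (w * s j) i ↔ IsDescent w i := by
        simp only [IsDescent, coe_mul_apply, s_apply]
        rw [if_neg (by omega), if_neg (by omega), if_neg (by omega), if_neg (by omega)]
      by_cases hi : IsDescent w i <;> by_cases hj : IsDescent w j <;>
        simp only [hi, hj, if_true, if_false, ih', hij', hji', dividedDiff_zero, mul_assoc, hcomm]
    · have hbraid : s i * (s (i + 1) * s i) = s (i + 1) * (s i * s (i + 1)) :=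
        Subtype.ext (Equiv.ext fun k => by
          simp only [coe_mul_apply, s_apply]
          split_ifs <;> omega)
      have hne : i ≠ i + 1 + 1 := by omega
      have h1 : IsDescent (w * s i) (i + 1) ↔ w.1 (i + 2) < w.1 i := by
        simp only [IsDescent, coe_mul_apply, s_apply]
        simp [hne.symm]
      have h2 : IsDescent (w * s (i + 1)) i ↔ w.1 (i + 2) < w.1 i := by
        simp only [IsDescent, coe_mul_apply, s_apply]
        simp [hne]
      have h3 : IsDescent (w * s i * s (i + 1)) i ↔ IsDescent w (i + 1) := by
        simp only [IsDescent, coe_mul_apply, s_apply]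
        simp [hne, hne.symm]
      have h4 : IsDescent (w * s (i + 1) * s i) (i + 1) ↔ IsDescent w i := by
        simp only [IsDescent, coe_mul_apply, s_apply]
        simp [hne, hne.symm]
      have ih2 : ∀ i j k, IsDescent w i → IsDescent (w * s i) j →
          dividedDiff k (pipeDreamPoly (w * s i * s j)) =
            if IsDescent (w * s i * s j) k then pipeDreamPoly (w * s i * s j * s k) else 0 := by
        intro i j k hi hj
        have e1 := length_mul_s_of_isDescent hi
        have e2 := length_mul_s_of_isDescent hj
        exact ih _ (by omega) (w * s i * s j) k rfl
      -- On either side the three divided differences are all nonzero steps exactly when w(i) >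
      -- w(i+1) > w(i+2). Both sides then lead to the same permutation by the braid relation, and
      -- otherwise both vanish.
      have hL : dividedDiff i (dividedDiff (i + 1)
          (if IsDescent w i then pipeDreamPoly (w * s i) else 0)) =
          if IsDescent w i ∧ IsDescent w (i + 1) then
            pipeDreamPoly (w * (s i * (s (i + 1) * s i))) else 0 := by
        by_cases hi : IsDescent w i
        · rw [if_pos hi, ih' i hi]
          by_cases hd : IsDescent (w * s i) (i + 1)
          · rw [if_pos hd, ih2 i (i + 1) i hi hd]
            simp only [h3, hi, true_and]
            simp only [mul_assoc]
          · rw [if_neg hd, dividedDiff_zero, if_neg]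
            rintro ⟨a, b⟩
            exact hd (h1.2 (lt_trans b a))
        · simp only [hi, if_false, false_and, dividedDiff_zero]
      have hR : dividedDiff (i + 1) (dividedDiff i
          (if IsDescent w (i + 1) then pipeDreamPoly (w * s (i + 1)) else 0)) =
          if IsDescent w i ∧ IsDescent w (i + 1) then
            pipeDreamPoly (w * (s (i + 1) * (s i * s (i + 1)))) else 0 := by
        by_cases hi : IsDescent w (i + 1)
        · rw [if_pos hi, ih' (i + 1) hi]
          by_cases hd : IsDescent (w * s (i + 1)) i
          · rw [if_pos hd, ih2 (i + 1) i (i + 1) hi hd]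
            simp only [h4, hi, and_true]
            simp only [mul_assoc]
          · rw [if_neg hd, dividedDiff_zero, if_neg]
            rintro ⟨a, b⟩
            exact hd (h2.2 (lt_trans b a))
        · simp only [hi, if_false, and_false, dividedDiff_zero]
      exact hL.trans (hbraid ▸ hR.symm)

theorem isSchubertFamily_pipeDreamPoly : IsSchubertFamily pipeDreamPoly where
  homogeneous w := ⟨length w, pdSum_isHomogeneous (exists_inSn w).choose_spec⟩
  one := by
    have hd : ∀ i, ¬ IsDescent 1 i := fun i => Nat.not_lt.2 i.le_succ
    -- With an empty range the recursion says that the polynomial is fixed by `R 0`, hence constant.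
    have h := pdSum_recursion_of_le (inSn_one 0) le_rfl
    rw [Finset.range_zero, Finset.sum_empty, add_zero] at h
    rw [pipeDreamPoly_eq (inSn_one 0), eq_C_of_R_zero_eq_self h.symm]
    classical
    rw [constantCoeff_pdSum (inSn_one 0), if_pos rfl, map_one]
  descent w i h := by rw [dividedDiff_pipeDreamPoly, if_pos h]
  ascent w i h := by rw [dividedDiff_pipeDreamPoly, if_neg h]

end Schubert

open Schubert in
theorem theorem3p4 :
    -- the Schubert polynomials are well defined
    (∃! S : SInf → Pol, IsSchubertFamily S) ∧
    -- the pipe dream formula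
    (∀ S : SInf → Pol, IsSchubertFamily S → ∀ (n : ℕ) (w : SInf), InSn n w →
      S w = ∑ D ∈ PD n w, weight D) ∧
    -- the recursion for the generating polynomials of pipe dreams
    (∀ (n : ℕ) (w : SInf), InSn n w →
      pdSum n w = R 0 (pdSum n w) +
        ∑ i ∈ (Finset.range n).filter (fun i => IsDescent w i),
          MvPolynomial.X i * R i (pdSum n (w * s i))) ∧
    -- the bijection for pipe dreams without crosses in the first column
    (∀ (n : ℕ) (w : SInf), InSn n w →
      Set.BijOn shiftAll {D | D ∈ PD n w ∧ Uncritical D} {D | D ∈ PD n w ∧ RowEmpty 0 D} ∧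
      ∀ D ∈ PD n w, Uncritical D → weight D = R 0 (weight (shiftAll D))) ∧
    -- the bijections for pipe dreams whose last cross in the first column is in row `i`
    (∀ (n : ℕ) (w : SInf), InSn n w → ∀ i : ℕ, IsDescent w i →
      Set.BijOn (shiftFrom i) {D | D ∈ PD n w ∧ Critical i D}
        {D | D ∈ PD n (w * s i) ∧ RowEmpty i D} ∧
      ∀ D ∈ PD n w, Critical i D →
        weight D = MvPolynomial.X i * R i (weight (shiftFrom i D))) := by
  refine ⟨⟨pipeDreamPoly, isSchubertFamily_pipeDreamPoly, fun S hS => funext fun w => ?_⟩,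
    fun S hS n w hw => hS.eq_pdSum hw, fun n w hw => pdSum_recursion hw,
    fun n w hw => ⟨bijOn_shiftAll hw, fun D _ hD => weight_eq_R_weight_shiftAll hD⟩,
    fun n w hw i hi => ⟨bijOn_shiftFrom hw hi,
      fun D _ hD => weight_eq_X_mul_R_weight_shiftFrom hD⟩⟩
  exact hS.eq_pdSum (exists_inSn w).choose_spec
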